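/- Let $c,\lambda,t>0$. Let $V$ be a random variable with $P(V=c)=P(V=-c)=\tfrac12$, let $N=(N(s))_{s\ge 0}$ be a homogeneous Poisson process with rate $\lambda$ (with nondecreasing right-continuous paths), independent of $V$, and let $\mathcal T(s)=\int_0^s V\,(-1)^{N(u)}\,du$ be the symmetric telegraph process with initial velocity $V(0)=V$. Put $M_t=\max_{0\le s\le t}\mathcal T(s)$. For $\nu\ge 0$ and $x>0$ let $I_\nu(x)=\sum_{j\ge 0}\frac{(x/2)^{2j+\nu}}{j!\,\Gamma(j+\nu+1)}$ be the modified Bessel function of the first kind. Then $M_t^m$ is integrable for every integer $m\ge 1$, and the following hold for all integers $m\ge 1$ and $k\ge 0$. 1. (Positive initial velocity.) $$\mathbb E[M_t^m\mid V(0)=c,N(t)=2k+1]=\mathbb E[M_t^m\mid V(0)=c,N(t)=2k+2]=\frac{(2k+1)!\,(ct)^m}{2^{2k+1}\,k!}\,\frac{\Gamma\left(\frac{m+1}{2}\right)}{\Gamma\left(k+1+\frac{m+1}{2}\right)}.$$ In particular $$\mathbb E[M_t\mid V(0)=c,N(t)=2k+1]=\binom{2k+1}{k}\frac{ct}{2^{2k+1}},\qquad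 \mathbb E[M_t^2\mid V(0)=c,N(t)=2k+1]=\frac{c^2t^2}{2k+3},$$ and the latter tends to $0$ as $k\to\infty$, that is, the maximum conditioned on $V(0)=c$, $N(t)=2k+1$ converges to $0$ in mean square. 2. (Positive initial velocity, number of reversals not fixed.) $$\mathbb E[M_t^m\mid V(0)=c]=e^{-\lambda t}(ct)^m\left(\frac{2}{\lambda t}\right)^{\frac{m-1}{2}}\Gamma\left(\frac{m+1}{2}\right)\left[I_{\frac{m-1}{2}}(\lambda t)+I_{\frac{m+1}{2}}(\lambda t)\right],$$ and in particular $\mathbb E[M_t\mid V(0)=c]=e^{-\lambda t}\,ct\,[I_0(\lambda t)+I_1(\lambda t)]$. 3. (Negative initial velocity, even number of reversals.) $$\mathbb E[M_t^m\mid V(0)=-c,N(t)=2k]=\frac{(2k)!\,(ct)^m}{2^{2k}\,k!}\left[\frac{\Gamma\left(\frac{m+1}{2}\right)}{\Gamma\left(k+\frac{m+1}{2}\right)}-\frac{\Gamma\left(\frac m2+1\right)}{\Gamma\left(k+1+\frac m2\right)}\right].$$ In particular $$\mathbb E[M_t\mid V(0)=-c,N(t)=2k]=ct\,\frac{(2k)!}{k!^2\,2^{2k}}-\frac{ct}{2k+1}=ct\,P\{M_t=0\mid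 V(0)=-c,N(t)=2k\}-\frac{ct}{2k+1},$$ and, as a function of $k\ge 0$, this mean has its unique maximum at $k=2$. 4. (Negative initial velocity, odd number of reversals.) $$\mathbb E[M_t^m\mid V(0)=-c,N(t)=2k+1]=\frac{2k+1}{2k+2}\,\mathbb E[M_t^m\mid V(0)=-c,N(t)=2k]+\frac{1}{2k+2}\,\mathbb E[M_t^m\mid V(0)=c,N(t)=2k+1].$$ -/

import Mathlib

open MeasureTheory ProbabilityTheory Filter Topology
open scoped NNReal ENNReal Nat

/-- `N` is a homogeneous Poisson process with rate `lam` under `P`: it starts at `0`, has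
independent increments, the increment over `(s, t]` is Poisson distributed with parameter
`lam * (t - s)`, and almost every path is nondecreasing and right-continuous. -/
structure IsPoissonProcess {Ω : Type*} [MeasurableSpace Ω] (N : ℝ≥0 → Ω → ℕ) (lam : ℝ≥0)
    (P : Measure Ω) : Prop where
  measurable : ∀ t, Measurable (N t)
  start : ∀ᵐ ω ∂P, N 0 ω = 0
  indep : HasIndepIncrements N P
  law : ∀ s t : ℝ≥0, s ≤ t →
    HasLaw (fun ω => N t ω - N s ω) (poissonMeasure (lam * (t - s))) P
  paths : ∀ᵐ ω ∂P, Monotone (fun s => N s ω) ∧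
    ∀ s, ContinuousWithinAt (fun r => N r ω) (Set.Ici s) s

/-- The data of a symmetric telegraph process with speed `c` and rate `lam`: an initial velocity
`V` which is `c` or `-c` with probability `1 / 2` each, and a homogeneous Poisson process `N` with
rate `lam`, independent of `V`. -/
structure IsTelegraphData {Ω : Type*} [MeasurableSpace Ω] (V : Ω → ℝ) (N : ℝ≥0 → Ω → ℕ)
    (c : ℝ) (lam : ℝ≥0) (P : Measure Ω) : Prop where
  measurable_velocity : Measurable V
  prob_pos : P {ω | V ω = c} = 1 / 2
  prob_neg : P {ω | V ω = -c} = 1 / 2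
  poisson : IsPoissonProcess N lam P
  indep : IndepFun V (fun ω s => N s ω) P

/-- The telegraph process: the position at time `t` is `∫₀ᵗ V (-1) ^ N(s) ds`. -/
noncomputable def telegraph {Ω : Type*} (V : Ω → ℝ) (N : ℝ≥0 → Ω → ℕ) (t : ℝ≥0) (ω : Ω) : ℝ :=
  ∫ s in (0 : ℝ)..t, V ω * (-1) ^ N s.toNNReal ω

/-- The maximum of the telegraph process over the time interval `[0, t]`. -/
noncomputable def telegraphMax {Ω : Type*} (V : Ω → ℝ) (N : ℝ≥0 → Ω → ℕ) (t : ℝ≥0) (ω : Ω) : ℝ :=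
  sSup ((fun s => telegraph V N s ω) '' Set.Icc 0 t)

/-- The supremum defining `telegraphMax` is attained whenever the path of `N` is nondecreasing. -/
theorem telegraphMax_isGreatest {Ω : Type*} (V : Ω → ℝ) (N : ℝ≥0 → Ω → ℕ) (t : ℝ≥0) (ω : Ω)
    (h : Monotone (fun s => N s ω)) :
    IsGreatest ((fun s => telegraph V N s ω) '' Set.Icc 0 t) (telegraphMax V N t ω) := by
  have hmeas : Measurable (fun s : ℝ => V ω * (-1 : ℝ) ^ N s.toNNReal ω) := by
    have h1 : Measurable (fun s : ℝ => N s.toNNReal ω) :=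
      Monotone.measurable fun a b hab => h (Real.toNNReal_le_toNNReal hab)
    exact measurable_const.mul ((measurable_from_nat (f := fun n => (-1 : ℝ) ^ n)).comp h1)
  have hint : ∀ a b : ℝ,
      IntervalIntegrable (fun s : ℝ => V ω * (-1 : ℝ) ^ N s.toNNReal ω) volume a b := by
    intro a b
    refine (intervalIntegrable_const (c := |V ω|)).mono_fun' hmeas.aestronglyMeasurable ?_
    exact Eventually.of_forall fun s => by simp
  have hcont : Continuous (fun s : ℝ≥0 => telegraph V N s ω) :=
    (intervalIntegral.continuous_primitive hint 0).comp NNReal.continuous_coe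
  exact (isCompact_Icc.image hcont).isGreatest_sSup
    ((Set.nonempty_Icc.2 (zero_le (a := t))).image _)

/-- The `m`-th moment of the maximum over `[0, t]` of the telegraph process, conditionally on the
event `A` (of positive probability): the integral with respect to `P( · | A)`. -/
noncomputable def condMaxMoment {Ω : Type*} [MeasurableSpace Ω] (P : Measure Ω) (V : Ω → ℝ)
    (N : ℝ≥0 → Ω → ℕ) (t : ℝ≥0) (m : ℕ) (A : Set Ω) : ℝ :=
  ∫ ω, telegraphMax V N t ω ^ m ∂(ProbabilityTheory.cond P A)

/-- The modified Bessel function of the first kind, for `x > 0`: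
`I_ν(x) = ∑_{j ≥ 0} (x / 2) ^ (2 j + ν) / (j! Γ(j + ν + 1))`. -/
noncomputable def besselI (ν x : ℝ) : ℝ :=
  ∑' j : ℕ, (x / 2) ^ (2 * (j : ℝ) + ν) / ((j ! : ℝ) * Real.Gamma ((j : ℝ) + ν + 1))

/-! Given the initial velocity and `N t = n`, the reversal times are distributed as `n` independent
uniform points of `(0, t]`. The conditional law of the maximum is therefore an integral over a cube,
`maxIntegral`, and by scaling the speed may be taken to be `1`.

That integral satisfies a recursion obtained by cutting the path at its first reversal time `s`. A
path starting upwards has maximum `s + X` and one starting downwards has maximum `max 0 (X - s)`,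
where `X` is the maximum of the remaining path, of length `t - s` and opposite initial direction.
The recursion (`maxIntegral_one_succ`, `maxIntegral_neg_one_succ`) preserves an explicit family of
polynomial densities on `(0, t)`, with an atom at `0` for downward starts. Up to constants these are
`(t - x) ^ k * (t + x) ^ k` for upward starts and its companions. Two inductions that alternate the
starting direction cover all parities: `negEven k`, `posOdd k`, `negEven (k + 1)`, and `negOdd k`,
`posEven k`, `negOdd (k + 1)`. Each integral in the recursion has an elementary primitive, and the
atom is found from the total mass `t ^ n / n!`.

Proportionality of `posEven` to `posOdd` gives the equality of moments in part 1, and the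
decomposition `negOdd_eq` gives part 4. The Gamma quotients come from
`integral_pow_mul_sub_mul_add`, a Beta integral in disguise. Part 2 is the Poisson mixture of part
1, whose even and odd terms are the series of two Bessel functions.

The uniform law of the reversal times is needed only through the maximum. On a grid of mesh `t / n`
the increments of `N` and the cell counts of uniform points have the same multinomial weights
(`IsTelegraphData.map_gridIncr`). Refining the grid transfers this to the maximum, which depends on
the velocity in a Lipschitz way for the `L¹` norm. -/

/-! ### Running maxima of deterministic paths. -/

/-- The running maximum over `[0, t]` of the path started at `0` with velocity `f`. -/
noncomputable def runMax (f : ℝ → ℝ) (t : ℝ) : ℝ :=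
  sSup ((fun s => ∫ r in (0 : ℝ)..s, f r) '' Set.Icc 0 t)

theorem runMax_isGreatest {f : ℝ → ℝ} (hf : ∀ a b, IntervalIntegrable f volume a b) {t : ℝ}
    (ht : 0 ≤ t) :
    IsGreatest ((fun s => ∫ r in (0 : ℝ)..s, f r) '' Set.Icc 0 t) (runMax f t) :=
  (isCompact_Icc.image (intervalIntegral.continuous_primitive hf 0)).isGreatest_sSup
    ((Set.nonempty_Icc.2 ht).image _)

theorem le_runMax {f : ℝ → ℝ} (hf : ∀ a b, IntervalIntegrable f volume a b) {s t : ℝ}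
    (hs : 0 ≤ s) (hst : s ≤ t) : ∫ r in (0 : ℝ)..s, f r ≤ runMax f t :=
  (runMax_isGreatest hf (hs.trans hst)).2 ⟨s, ⟨hs, hst⟩, rfl⟩

theorem exists_eq_runMax {f : ℝ → ℝ} (hf : ∀ a b, IntervalIntegrable f volume a b) {t : ℝ}
    (ht : 0 ≤ t) : ∃ s, 0 ≤ s ∧ s ≤ t ∧ runMax f t = ∫ r in (0 : ℝ)..s, f r := by
  obtain ⟨s, hs, h⟩ := (runMax_isGreatest hf ht).1
  exact ⟨s, hs.1, hs.2, h.symm⟩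

theorem runMax_eq {f : ℝ → ℝ} {t x : ℝ} (h1 : ∀ s, 0 ≤ s → s ≤ t → ∫ r in (0 : ℝ)..s, f r ≤ x)
    (h2 : ∃ s, 0 ≤ s ∧ s ≤ t ∧ ∫ r in (0 : ℝ)..s, f r = x) : runMax f t = x := by
  obtain ⟨s, hs, hst, h⟩ := h2
  refine IsGreatest.csSup_eq ⟨⟨s, ⟨hs, hst⟩, h⟩, ?_⟩
  rintro _ ⟨r, hr, rfl⟩
  exact h1 r hr.1 hr.2

theorem runMax_nonneg {f : ℝ → ℝ} (hf : ∀ a b, IntervalIntegrable f volume a b) {t : ℝ}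
    (ht : 0 ≤ t) : 0 ≤ runMax f t := by
  simpa using le_runMax hf le_rfl ht

theorem runMax_le {f : ℝ → ℝ} (hf : ∀ a b, IntervalIntegrable f volume a b) {t : ℝ}
    (ht : 0 ≤ t) (hb : ∀ r, |f r| ≤ 1) : runMax f t ≤ t := by
  obtain ⟨s, hs, hst, h⟩ := exists_eq_runMax hf ht
  rw [h]
  have := intervalIntegral.norm_integral_le_of_norm_le_const (a := 0) (b := s) (C := 1)
    (f := f) (fun r _ => hb r)
  rw [Real.norm_eq_abs, sub_zero, abs_of_nonneg hs, one_mul] at this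
  exact (le_abs_self _).trans (this.trans hst)

/-- At a time where one path attains its maximum, the other path is lower by at most the `L¹`
distance of the velocities; exchanging the roles gives the absolute value. This stability is what
lets grid approximations converge. -/
theorem abs_runMax_sub_le {f g : ℝ → ℝ} (hf : ∀ a b, IntervalIntegrable f volume a b)
    (hg : ∀ a b, IntervalIntegrable g volume a b) {t : ℝ} (ht : 0 ≤ t) :
    |runMax f t - runMax g t| ≤ ∫ r in (0 : ℝ)..t, |f r - g r| := by
  have key : ∀ {f g : ℝ → ℝ}, (∀ a b, IntervalIntegrable f volume a b) →
      (∀ a b, IntervalIntegrable g volume a b) →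
      runMax f t - runMax g t ≤ ∫ r in (0 : ℝ)..t, |f r - g r| := by
    intro f g hf hg
    obtain ⟨s, hs, hst, h⟩ := exists_eq_runMax hf ht
    have h1 := le_runMax hg hs hst
    have h2 : ∫ r in (0 : ℝ)..s, (f r - g r) ≤ ∫ r in (0 : ℝ)..s, |f r - g r| :=
      intervalIntegral.integral_mono_on hs ((hf _ _).sub (hg _ _)) ((hf _ _).sub (hg _ _)).abs
        fun r _ => le_abs_self _
    have h3 : ∫ r in (0 : ℝ)..s, |f r - g r| ≤ ∫ r in (0 : ℝ)..t, |f r - g r| :=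
      intervalIntegral.integral_mono_interval le_rfl hs hst
        (Eventually.of_forall fun r => abs_nonneg _) ((hf _ _).sub (hg _ _)).abs
    rw [intervalIntegral.integral_sub (hf _ _) (hg _ _)] at h2
    linarith
  rw [abs_le]
  have h1 := key hf hg
  have h2 := key hg hf
  simp_rw [abs_sub_comm (g _)] at h2
  constructor <;> linarith

theorem runMax_const_mul {f : ℝ → ℝ} (hf : ∀ a b, IntervalIntegrable f volume a b) {t c : ℝ}
    (ht : 0 ≤ t) (hc : 0 ≤ c) : runMax (fun r => c * f r) t = c * runMax f t := by
  apply runMax_eq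
  · intro s hs hst
    rw [intervalIntegral.integral_const_mul]
    exact mul_le_mul_of_nonneg_left (le_runMax hf hs hst) hc
  · obtain ⟨s, hs, hst, h⟩ := exists_eq_runMax hf ht
    exact ⟨s, hs, hst, by rw [intervalIntegral.integral_const_mul, h]⟩

theorem integral_eq_of_shift {f h : ℝ → ℝ} (hf : ∀ a b, IntervalIntegrable f volume a b) {v s x : ℝ}
    (hs : 0 ≤ s) (hx : 0 ≤ x) (h1 : ∀ r ∈ Set.Ioo 0 s, f r = v)
    (h2 : ∀ r, 0 ≤ r → f (s + r) = h r) :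
    ∫ r in (0 : ℝ)..(s + x), f r = s * v + ∫ r in (0 : ℝ)..x, h r := by
  rw [← intervalIntegral.integral_add_adjacent_intervals (hf 0 s) (hf s _)]
  congr 1
  · rw [intervalIntegral.integral_of_le hs, integral_Ioc_eq_integral_Ioo,
      setIntegral_congr_fun measurableSet_Ioo h1]
    simp [hs]
  · have : ∫ r in (0 : ℝ)..x, f (s + r) = ∫ r in s..(s + x), f r := by
      simp [intervalIntegral.integral_comp_add_left]
    rw [← this]
    refine intervalIntegral.integral_congr fun r hr => ?_
    rw [Set.uIcc_of_le hx] at hr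
    exact h2 r hr.1

theorem integral_eq_of_const {f : ℝ → ℝ} {v s x : ℝ} (hx : 0 ≤ x) (hxs : x ≤ s)
    (h1 : ∀ r ∈ Set.Ioo 0 s, f r = v) : ∫ r in (0 : ℝ)..x, f r = x * v := by
  rw [intervalIntegral.integral_of_le hx, integral_Ioc_eq_integral_Ioo,
    setIntegral_congr_fun measurableSet_Ioo fun r hr => h1 r ⟨hr.1, hr.2.trans_le hxs⟩]
  simp [hx]

/-- A path that goes up until time `s` and then continues with velocity `h`. -/
theorem runMax_up {f h : ℝ → ℝ} (hf : ∀ a b, IntervalIntegrable f volume a b)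
    (hh : ∀ a b, IntervalIntegrable h volume a b) {s t : ℝ} (hs : 0 ≤ s) (hst : s ≤ t)
    (h1 : ∀ r ∈ Set.Ioo 0 s, f r = 1) (h2 : ∀ r, 0 ≤ r → f (s + r) = h r) :
    runMax f t = s + runMax h (t - s) := by
  apply runMax_eq
  · intro x hx hxt
    rcases le_total x s with hxs | hxs
    · rw [integral_eq_of_const hx hxs h1]
      have := runMax_nonneg hh (sub_nonneg.2 hst)
      linarith
    · have := integral_eq_of_shift hf hs (sub_nonneg.2 hxs) h1 h2
      rw [add_sub_cancel] at this
      rw [this, mul_one]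
      gcongr
      exact le_runMax hh (by linarith) (by linarith)
  · obtain ⟨x, hx, hxt, h⟩ := exists_eq_runMax hh (sub_nonneg.2 hst)
    exact ⟨s + x, by linarith, by linarith, by rw [integral_eq_of_shift hf hs hx h1 h2, h, mul_one]⟩

/-- A path that goes down until time `s` and then continues with velocity `h`. -/
theorem runMax_down {f h : ℝ → ℝ} (hf : ∀ a b, IntervalIntegrable f volume a b)
    (hh : ∀ a b, IntervalIntegrable h volume a b) {s t : ℝ} (hs : 0 ≤ s) (hst : s ≤ t)
    (h1 : ∀ r ∈ Set.Ioo 0 s, f r = -1) (h2 : ∀ r, 0 ≤ r → f (s + r) = h r) :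
    runMax f t = max 0 (runMax h (t - s) - s) := by
  apply runMax_eq
  · intro x hx hxt
    rcases le_total x s with hxs | hxs
    · rw [integral_eq_of_const hx hxs h1]
      exact le_max_of_le_left (by linarith)
    · have := integral_eq_of_shift hf hs (sub_nonneg.2 hxs) h1 h2
      rw [add_sub_cancel] at this
      rw [this]
      apply le_max_of_le_right
      have := le_runMax hh (sub_nonneg.2 hxs) (sub_le_sub_right hxt s)
      linarith
  · rcases le_total 0 (runMax h (t - s) - s) with h0 | h0
    · rw [max_eq_right h0]
      obtain ⟨x, hx, hxt, h⟩ := exists_eq_runMax hh (sub_nonneg.2 hst)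
      exact ⟨s + x, by linarith, by linarith,
        by rw [integral_eq_of_shift hf hs hx h1 h2, h]; ring⟩
    · rw [max_eq_left h0]
      exact ⟨0, le_rfl, hs.trans hst, by simp⟩

theorem runMax_one {t : ℝ} (ht : 0 ≤ t) : runMax (fun _ => 1) t = t :=
  runMax_eq (fun s _ hst => by simpa using hst) ⟨t, ht, le_rfl, by simp⟩

theorem runMax_neg_one {t : ℝ} (ht : 0 ≤ t) : runMax (fun _ => -1) t = 0 :=
  runMax_eq (fun s hs _ => by simpa using hs) ⟨0, le_rfl, ht, by simp⟩

/-! ### Reversal counts, point configurations and grid approximation. -/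

/-- The velocity of a path with initial velocity `v` that is reversed at each jump of `ν`. -/
def velocity (v : ℝ) (ν : ℝ → ℕ) (r : ℝ) : ℝ := v * (-1) ^ ν r

theorem abs_velocity (v : ℝ) (ν : ℝ → ℕ) (r : ℝ) : |velocity v ν r| = |v| := by
  simp [velocity, abs_mul]

theorem measurable_velocity (v : ℝ) {ν : ℝ → ℕ} (hν : Monotone ν) : Measurable (velocity v ν) :=
  measurable_const.mul ((measurable_from_nat (f := fun n => (-1 : ℝ) ^ n)).comp hν.measurable)

theorem intervalIntegrable_velocity (v : ℝ) {ν : ℝ → ℕ} (hν : Monotone ν) (a b : ℝ) :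
    IntervalIntegrable (velocity v ν) volume a b := by
  refine (intervalIntegrable_const (c := |v|)).mono_fun'
    (measurable_velocity v hν).aestronglyMeasurable ?_
  exact Eventually.of_forall fun s => (abs_velocity v ν s).le

theorem telegraphMax_eq_runMax {Ω : Type*} (V : Ω → ℝ) (N : ℝ≥0 → Ω → ℕ) (t : ℝ≥0) (ω : Ω) :
    telegraphMax V N t ω = runMax (velocity (V ω) fun s => N s.toNNReal ω) t := by
  unfold telegraphMax runMax telegraph velocity
  congr 1
  ext x
  constructor
  · rintro ⟨s, hs, rfl⟩
    exact ⟨s, ⟨s.2, by exact_mod_cast hs.2⟩, rfl⟩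
  · rintro ⟨s, hs, rfl⟩
    exact ⟨⟨s, hs.1⟩, ⟨zero_le, by exact_mod_cast hs.2⟩, rfl⟩

/-- The number of points of the configuration `u` in `(-∞, r]`. -/
noncomputable def pointCount {k : ℕ} (u : Fin k → ℝ) (r : ℝ) : ℕ :=
  ∑ i, if u i ≤ r then 1 else 0

theorem monotone_pointCount {k : ℕ} (u : Fin k → ℝ) : Monotone (pointCount u) := by
  intro a b hab
  refine Finset.sum_le_sum fun i _ => ?_
  split_ifs with h1 h2 <;> first | omega | exact absurd (h1.trans hab) h2

theorem measurable_pointCount {k : ℕ} (r : ℝ) : Measurable fun u : Fin k → ℝ => pointCount u r :=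
  Finset.measurable_sum _ fun i _ =>
    Measurable.ite (measurableSet_le (measurable_pi_apply i) measurable_const)
      measurable_const measurable_const

/-- The index of the cell of the grid `0, t / n, 2 t / n, …, t` that contains `r`. -/
noncomputable def gridIndex (n : ℕ) (t r : ℝ) : Fin (n + 1) :=
  ⟨min ⌊r / t * n⌋₊ n, Nat.lt_succ_of_le (min_le_right _ _)⟩

/-- The running maximum of a path whose velocity changes only at the points of the grid, where
`b j` is the number of reversals up to time `t * j / n`. -/
noncomputable def gridMax (v t : ℝ) (n : ℕ) (b : Fin (n + 1) → ℕ) : ℝ :=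
  runMax (velocity v fun r => b (gridIndex n t r)) t

/-- The values of `ν` on the grid. -/
noncomputable def gridValues (t : ℝ) (n : ℕ) (ν : ℝ → ℕ) (j : Fin (n + 1)) : ℕ :=
  ν (t * (j / n))

theorem monotone_gridIndex (n : ℕ) {t : ℝ} (ht : 0 < t) : Monotone (gridIndex n t) := by
  intro a b hab
  refine Fin.mk_le_mk.2 (min_le_min_right _ (Nat.floor_mono ?_))
  gcongr

theorem monotone_gridValues {t : ℝ} (ht : 0 < t) (n : ℕ) {ν : ℝ → ℕ} (hν : Monotone ν) :
    Monotone (gridValues t n ν) := by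
  intro a b hab
  apply hν
  have : (a : ℝ) ≤ b := by exact_mod_cast hab
  gcongr

/-- On `(0, t]` the floor never exceeds `n`, so the truncation in `gridIndex` is inactive and the
usual limit of `⌊a n⌋ / n` applies. -/
theorem tendsto_gridIndex {t r : ℝ} (ht : 0 < t) (hr : r ∈ Set.Ioc 0 t) :
    Tendsto (fun n : ℕ => t * ((gridIndex n t r : ℕ) / n : ℝ)) atTop (𝓝 r) := by
  have h0 : 0 ≤ r / t := (div_pos hr.1 ht).le
  have h := ((tendsto_nat_floor_mul_div_atTop h0).comp
    (tendsto_natCast_atTop_atTop (R := ℝ))).const_mul t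
  rw [mul_div_cancel₀ _ ht.ne'] at h
  refine h.congr fun n => ?_
  have h1 : r / t * n ≤ n := by
    have : r / t ≤ 1 := (div_le_one ht).2 hr.2
    exact mul_le_of_le_one_left (by positivity) this
  have : ⌊r / t * n⌋₊ ≤ n := Nat.floor_le_of_le h1
  simp [gridIndex, min_eq_left this]

/-- A monotone `ν` is continuous off a countable set, where its grid values converge. Dominated
convergence makes the velocities converge in `L¹`, and `abs_runMax_sub_le` passes this to the
maxima. -/
theorem tendsto_gridMax (v : ℝ) {t : ℝ} (ht : 0 < t) {ν : ℝ → ℕ} (hν : Monotone ν) :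
    Tendsto (fun n => gridMax v t n (gridValues t n ν)) atTop (𝓝 (runMax (velocity v ν) t)) := by
  have hm : ∀ n, Monotone fun r => gridValues t n ν (gridIndex n t r) := fun n =>
    (monotone_gridValues ht n hν).comp (monotone_gridIndex n ht)
  have key : Tendsto (fun n : ℕ => ∫ r in (0 : ℝ)..t,
      |velocity v (fun r => gridValues t n ν (gridIndex n t r)) r - velocity v ν r|) atTop
      (𝓝 (∫ r in (0 : ℝ)..t, (0 : ℝ))) := by
    refine intervalIntegral.tendsto_integral_filter_of_dominated_convergence (fun _ => 2 * |v|)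
      ?_ ?_ intervalIntegrable_const ?_
    · refine Eventually.of_forall fun n => Measurable.aestronglyMeasurable ?_
      exact ((measurable_velocity v (hm n)).sub (measurable_velocity v hν)).abs
    · refine Eventually.of_forall fun n => Eventually.of_forall fun r _ => ?_
      rw [Real.norm_eq_abs, abs_abs]
      refine (abs_sub _ _).trans ?_
      rw [abs_velocity, abs_velocity]
      linarith
    · have hc : ∀ᵐ r : ℝ, ContinuousAt ν r :=
        (Set.Countable.ae_notMem hν.countable_not_continuousAt volume).mono
          fun r hr => by simpa using hr
      filter_upwards [hc] with r hr hrt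
      rw [Set.uIoc_of_le ht.le] at hrt
      have h1 := hr.tendsto.comp (tendsto_gridIndex ht hrt)
      have h2 : Tendsto (fun n : ℕ => velocity v (fun r => gridValues t n ν (gridIndex n t r)) r)
          atTop (𝓝 (velocity v ν r)) :=
        ((continuous_of_discreteTopology (f := fun n : ℕ => v * (-1 : ℝ) ^ n)).tendsto _).comp h1
      simpa using (h2.sub_const (velocity v ν r)).abs
  rw [intervalIntegral.integral_zero] at key
  rw [tendsto_iff_dist_tendsto_zero]
  refine squeeze_zero (fun _ => dist_nonneg) (fun n => ?_) key
  exact abs_runMax_sub_le (intervalIntegrable_velocity v (hm n)) (intervalIntegrable_velocity v hν)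
    ht.le

/-- Grid paths form a countable discrete space, so no analysis of the supremum is needed;
measurability of the true maximum follows by taking limits. -/
theorem measurable_gridMax (v t : ℝ) (n : ℕ) : Measurable (gridMax v t n) :=
  measurable_of_countable _

theorem measurable_gridValues_pointCount (t : ℝ) (n k : ℕ) :
    Measurable fun u : Fin k → ℝ => gridValues t n (pointCount u) :=
  measurable_pi_lambda _ fun _ => measurable_pointCount _

theorem measurable_runMax_pointCount (v : ℝ) {t : ℝ} (ht : 0 < t) (k : ℕ) :
    Measurable fun u : Fin k → ℝ => runMax (velocity v (pointCount u)) t := by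
  have h1 : ∀ n : ℕ, Measurable fun u : Fin k → ℝ =>
      gridMax v t n (gridValues t n (pointCount u)) := fun n =>
    (measurable_gridMax v t n).comp (measurable_gridValues_pointCount t n k)
  refine measurable_of_tendsto_metrizable h1 ?_
  exact tendsto_pi_nhds.2 fun u => tendsto_gridMax v ht (monotone_pointCount u)

theorem pointCount_cons {k : ℕ} (s : ℝ) (w : Fin k → ℝ) (r : ℝ) :
    pointCount (Fin.cons s w : Fin (k + 1) → ℝ) r = (if s ≤ r then 1 else 0) + pointCount w r := by
  rw [pointCount, Fin.sum_univ_succ]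
  simp [pointCount]

/-- Counting ignores the labels of the points, so the earliest one can always be moved to the front.
-/
theorem pointCount_eq_cons {k : ℕ} (u : Fin (k + 1) → ℝ) (i : Fin (k + 1)) :
    pointCount u = pointCount (Fin.cons (u i) (fun j => u (i.succAbove j)) : Fin (k + 1) → ℝ) := by
  ext r
  rw [pointCount_cons, pointCount, Fin.sum_univ_succAbove _ i]
  rfl

theorem pointCount_add {k : ℕ} (s : ℝ) (w : Fin k → ℝ) (r : ℝ) :
    pointCount (fun i => w i + s) (s + r) = pointCount w r := by
  refine Finset.sum_congr rfl fun i _ => ?_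
  simp [add_comm s r]

theorem pointCount_eq_zero {k : ℕ} {w : Fin k → ℝ} {r : ℝ} (h : ∀ i, r < w i) :
    pointCount w r = 0 :=
  Finset.sum_eq_zero fun i _ => if_neg (h i).not_ge

/-! ### Integration over reversal times and the first-reversal recursion. -/

/-- The integral of `g` of the running maximum over all configurations of `k` reversal times in
`(0, t]`, the initial velocity being `v`. -/
noncomputable def maxIntegral (v : ℝ) (k : ℕ) (t : ℝ) (g : ℝ → ℝ≥0∞) : ℝ≥0∞ :=
  ∫⁻ u in Set.univ.pi fun _ : Fin k => Set.Ioc 0 t, g (runMax (velocity v (pointCount u)) t)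

/-- Two coordinates coincide only on a null set, because by Fubini each slice is a coordinate
hyperplane; without ties the minimum is strict. -/
theorem ae_exists_lt_succAbove (k : ℕ) :
    ∀ᵐ u : Fin (k + 1) → ℝ, ∃ i, ∀ j, u i < u (i.succAbove j) := by
  have h : ∀ (i : Fin (k + 1)) (j : Fin k), ∀ᵐ u : Fin (k + 1) → ℝ, u i ≠ u (i.succAbove j) := by
    intro i j
    have hm : MeasurableSet {p : ℝ × (Fin k → ℝ) | p.1 = p.2 j} :=
      measurableSet_eq_fun measurable_fst ((measurable_pi_apply j).comp measurable_snd)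
    have h0 : (volume : Measure (ℝ × (Fin k → ℝ))) {p | p.1 = p.2 j} = 0 := by
      rw [Measure.volume_eq_prod, Measure.measure_prod_null hm]
      refine Eventually.of_forall fun s => ?_
      have := Measure.pi_hyperplane (fun _ : Fin k => (volume : Measure ℝ)) j s
      simpa [Set.preimage, eq_comm, volume_pi] using this
    have h1 := (volume_preserving_piFinSuccAbove (fun _ : Fin (k + 1) => ℝ) i).measure_preimage
      hm.nullMeasurableSet
    rw [h0] at h1
    rw [ae_iff]
    convert! h1 using 2
    ext u
    simp [MeasurableEquiv.piFinSuccAbove, Fin.insertNthEquiv, Fin.removeNth]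
  filter_upwards [ae_all_iff.2 fun i => ae_all_iff.2 (h i)] with u hu
  obtain ⟨i, -, hi⟩ := Finset.exists_min_image Finset.univ u Finset.univ_nonempty
  exact ⟨i, fun j => lt_of_le_of_ne (hi _ (Finset.mem_univ _)) (hu i j)⟩

theorem measurable_runMax_cons (v : ℝ) {t : ℝ} (ht : 0 < t) (k : ℕ) :
    Measurable fun p : ℝ × (Fin k → ℝ) =>
      runMax (velocity v (pointCount (Fin.cons p.1 p.2 : Fin (k + 1) → ℝ))) t := by
  have h := (measurable_runMax_pointCount v ht (k + 1)).comp
    (MeasurableEquiv.piFinSuccAbove (fun _ : Fin (k + 1) => ℝ) 0).symm.measurable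
  have : ⇑(MeasurableEquiv.piFinSuccAbove (fun _ : Fin (k + 1) => ℝ) 0).symm =
      fun p : ℝ × (Fin k → ℝ) => Fin.cons p.1 p.2 :=
    funext fun p => Fin.insertNth_zero' p.1 p.2
  rwa [this] at h

theorem lintegral_Ioc_shift {k : ℕ} (s t : ℝ) (F : (Fin k → ℝ) → ℝ≥0∞) :
    ∫⁻ w in Set.univ.pi fun _ : Fin k => Set.Ioc s t, F w =
      ∫⁻ w in Set.univ.pi fun _ : Fin k => Set.Ioc 0 (t - s), F fun i => w i + s := by
  have h := (measurePreserving_add_right (volume : Measure (Fin k → ℝ)) fun _ => s)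
  have he : MeasurableEmbedding fun w : Fin k → ℝ => w + fun _ => s :=
    measurableEmbedding_addRight _
  rw [← h.setLIntegral_comp_preimage_emb he]
  congr 2
  ext w
  simp [Set.mem_pi, le_sub_iff_add_le]

/-- Splitting off the first reversal time. -/
theorem maxIntegral_succ (v : ℝ) (k : ℕ) {t : ℝ} (ht : 0 < t) {g : ℝ → ℝ≥0∞} (hg : Measurable g) :
    maxIntegral v (k + 1) t g = (k + 1 : ℕ) * ∫⁻ s in Set.Ioc 0 t,
      ∫⁻ w in Set.univ.pi fun _ : Fin k => Set.Ioc 0 (t - s),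
        g (runMax (velocity v (pointCount (Fin.cons s fun i => w i + s : Fin (k + 1) → ℝ))) t) := by
  set H : ℝ × (Fin k → ℝ) → ℝ≥0∞ := fun p =>
    g (runMax (velocity v (pointCount (Fin.cons p.1 p.2 : Fin (k + 1) → ℝ))) t) with hH
  have hHm : Measurable H := hg.comp (measurable_runMax_cons v ht k)
  -- `B` is the region where the distinguished point comes strictly before all others.
  set B : Set (ℝ × (Fin k → ℝ)) := {p | p.1 ∈ Set.Ioc 0 t ∧ ∀ j, p.2 j ∈ Set.Ioc p.1 t} with hB
  have hBm : MeasurableSet B := by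
    have h1 : MeasurableSet {p : ℝ × (Fin k → ℝ) | p.1 ∈ Set.Ioc 0 t} :=
      measurable_fst measurableSet_Ioc
    have h2 : ∀ j, MeasurableSet {p : ℝ × (Fin k → ℝ) | p.2 j ∈ Set.Ioc p.1 t} := fun j =>
      by
      have hj : Measurable fun p : ℝ × (Fin k → ℝ) => p.2 j := by fun_prop
      have : {p : ℝ × (Fin k → ℝ) | p.2 j ∈ Set.Ioc p.1 t} = {p | p.1 < p.2 j} ∩ {p | p.2 j ≤ t} := by
        ext; rfl
      rw [this]
      exact (measurableSet_lt measurable_fst hj).inter (measurableSet_le hj measurable_const)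
    have : B = {p | p.1 ∈ Set.Ioc 0 t} ∩ ⋂ j, {p | p.2 j ∈ Set.Ioc p.1 t} := by
      ext p; simp [hB]
    rw [this]
    exact h1.inter (MeasurableSet.iInter h2)
  let e := fun i => MeasurableEquiv.piFinSuccAbove (fun _ : Fin (k + 1) => ℝ) i
  have he : ∀ i u, e i u = (u i, fun j => u (i.succAbove j)) := fun i u => rfl
  have hterm : ∀ i, ∫⁻ u in e i ⁻¹' B, g (runMax (velocity v (pointCount u)) t) =
      ∫⁻ p in B, H p := by
    intro i
    rw [← (volume_preserving_piFinSuccAbove (fun _ : Fin (k + 1) => ℝ) i).setLIntegral_comp_preimage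
      hBm hHm]
    refine setLIntegral_congr_fun ((e i).measurable hBm) fun u _ => ?_
    simp only [hH]
    rw [pointCount_eq_cons u i]
    rfl
  have hdisj : Pairwise fun i j => Disjoint (e i ⁻¹' B) (e j ⁻¹' B) := by
    intro i j hij
    rw [Set.disjoint_left]
    intro u hi hj
    obtain ⟨a, rfl⟩ := Fin.exists_succAbove_eq hij.symm
    obtain ⟨b, hb⟩ := Fin.exists_succAbove_eq hij
    have h1 := (hi.2 a).1
    have h2 := (hj.2 b).1
    simp only [he] at h1 h2
    rw [hb] at h2
    exact lt_asymm h1 h2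
  -- Up to ties, the cube splits into `k + 1` disjoint pieces according to which coordinate is
  -- smallest. By symmetry all contribute equally, whence the factor `k + 1`.
  have hunion : (Set.univ.pi fun _ : Fin (k + 1) => Set.Ioc 0 t) =ᵐ[volume] ⋃ i, e i ⁻¹' B := by
    rw [Filter.eventuallyEq_set]
    filter_upwards [ae_exists_lt_succAbove k] with u hu
    obtain ⟨i, hi⟩ := hu
    simp only [Set.mem_pi, Set.mem_iUnion, Set.mem_univ, true_imp_iff, Set.mem_preimage, he, hB,
      Set.mem_ofPred_eq]
    constructor
    · exact fun h => ⟨i, h i, fun j => ⟨hi j, (h _).2⟩⟩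
    · rintro ⟨a, ha, hb⟩ l
      rcases eq_or_ne l a with rfl | hla
      · exact ha
      · obtain ⟨b, rfl⟩ := Fin.exists_succAbove_eq hla
        exact ⟨ha.1.trans (hb b).1, (hb b).2⟩
  rw [maxIntegral, setLIntegral_congr hunion,
    lintegral_iUnion (fun i => (e i).measurable hBm) hdisj]
  simp_rw [hterm]
  rw [tsum_fintype, Finset.sum_const, Finset.card_univ, Fintype.card_fin, nsmul_eq_mul]
  congr 1
  rw [← lintegral_indicator hBm, Measure.volume_eq_prod,
    lintegral_prod _ (hHm.indicator hBm).aemeasurable, ← lintegral_indicator measurableSet_Ioc]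
  refine lintegral_congr fun s => ?_
  by_cases hs : s ∈ Set.Ioc 0 t
  · rw [Set.indicator_of_mem hs, ← lintegral_Ioc_shift s t fun w =>
      g (runMax (velocity v (pointCount (Fin.cons s w : Fin (k + 1) → ℝ))) t),
      ← lintegral_indicator (MeasurableSet.univ_pi fun _ => measurableSet_Ioc)]
    refine lintegral_congr fun w => ?_
    simp only [Set.indicator, hB, Set.mem_ofPred_eq, hs, true_and, Set.mem_pi, Set.mem_univ,
      true_imp_iff, hH]
  · rw [Set.indicator_of_notMem hs]
    simp only [Set.indicator, hB, Set.mem_ofPred_eq, hs, false_and, if_false, lintegral_zero]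

theorem velocity_cons (v : ℝ) {k : ℕ} (s : ℝ) {w : Fin k → ℝ}
    (hw : ∀ i, 0 < w i) :
    (∀ r ∈ Set.Ioo 0 s,
      velocity v (pointCount (Fin.cons s fun i => w i + s : Fin (k + 1) → ℝ)) r = v) ∧
    (∀ r, 0 ≤ r → velocity v (pointCount (Fin.cons s fun i => w i + s : Fin (k + 1) → ℝ)) (s + r) =
      velocity (-v) (pointCount w) r) := by
  constructor
  · intro r hr
    rw [velocity, pointCount_eq_zero, pow_zero, mul_one]
    intro i
    refine Fin.cases ?_ (fun i => ?_) i
    · simpa using hr.2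
    · simp only [Fin.cons_succ]
      linarith [hr.2, hw i]
  · intro r hr
    rw [velocity, pointCount_cons, pointCount_add, if_pos (by linarith), velocity, pow_add]
    ring

theorem maxIntegral_one_succ (k : ℕ) {t : ℝ} (ht : 0 < t) {g : ℝ → ℝ≥0∞} (hg : Measurable g) :
    maxIntegral 1 (k + 1) t g = (k + 1 : ℕ) * ∫⁻ s in Set.Ioc 0 t,
      maxIntegral (-1) k (t - s) fun x => g (s + x) := by
  rw [maxIntegral_succ 1 k ht hg]
  congr 1
  refine setLIntegral_congr_fun measurableSet_Ioc fun s hs => ?_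
  refine setLIntegral_congr_fun (MeasurableSet.univ_pi fun _ => measurableSet_Ioc) fun w hw => ?_
  obtain ⟨h1, h2⟩ := velocity_cons 1 s fun i => (hw i (Set.mem_univ i)).1
  simp only
  rw [runMax_up (intervalIntegrable_velocity _ (monotone_pointCount _))
    (intervalIntegrable_velocity _ (monotone_pointCount _)) hs.1.le hs.2 h1 h2]

theorem maxIntegral_neg_one_succ (k : ℕ) {t : ℝ} (ht : 0 < t) {g : ℝ → ℝ≥0∞} (hg : Measurable g) :
    maxIntegral (-1) (k + 1) t g = (k + 1 : ℕ) * ∫⁻ s in Set.Ioc 0 t,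
      maxIntegral 1 k (t - s) fun x => g (max 0 (x - s)) := by
  rw [maxIntegral_succ (-1) k ht hg]
  congr 1
  refine setLIntegral_congr_fun measurableSet_Ioc fun s hs => ?_
  refine setLIntegral_congr_fun (MeasurableSet.univ_pi fun _ => measurableSet_Ioc) fun w hw => ?_
  obtain ⟨h1, h2⟩ := velocity_cons (-1) s fun i => (hw i (Set.mem_univ i)).1
  simp only [neg_neg] at h2 ⊢
  rw [runMax_down (intervalIntegrable_velocity _ (monotone_pointCount _))
    (intervalIntegrable_velocity _ (monotone_pointCount _)) hs.1.le hs.2 h1 h2]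

theorem maxIntegral_zero {v : ℝ} {t : ℝ} (g : ℝ → ℝ≥0∞) :
    maxIntegral v 0 t g = g (runMax (fun _ => v) t) := by
  have : (Set.univ.pi fun _ : Fin 0 => Set.Ioc 0 t) = Set.univ := by
    ext; simp
  rw [maxIntegral, this, Measure.restrict_univ, volume_pi, Measure.pi_of_empty, lintegral_dirac]
  congr 2
  ext r
  simp [velocity, pointCount]

/-- The volume of the cube. It fixes the atoms of the laws below and the integrals of the densities.
-/
theorem maxIntegral_const_one (v : ℝ) (k : ℕ) {t : ℝ} :
    maxIntegral v k t (fun _ => 1) = ENNReal.ofReal t ^ k := by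
  rw [maxIntegral, lintegral_const, one_mul, Measure.restrict_apply_univ, volume_pi_pi]
  simp

/-! ### Transfer of the recursion to atoms and densities. -/

/-- Tonelli for a planar region described by its sections in either direction; the regions needed
below are triangles. -/
theorem lintegral_lintegral_swap_of_mem_iff {A A' : Set ℝ} {B B' : ℝ → Set ℝ} (hA : MeasurableSet A)
    (hA' : MeasurableSet A') (hB : ∀ s, MeasurableSet (B s)) (hB' : ∀ y, MeasurableSet (B' y))
    (hR : MeasurableSet {p : ℝ × ℝ | p.1 ∈ A ∧ p.2 ∈ B p.1})
    (h : ∀ s y, (s ∈ A ∧ y ∈ B s) ↔ (y ∈ A' ∧ s ∈ B' y)) {F : ℝ → ℝ → ℝ≥0∞}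
    (hF : Measurable (Function.uncurry F)) :
    ∫⁻ s in A, ∫⁻ y in B s, F s y = ∫⁻ y in A', ∫⁻ s in B' y, F s y := by
  classical
  set G : ℝ → ℝ → ℝ≥0∞ := fun s y => if s ∈ A ∧ y ∈ B s then F s y else 0 with hG
  have hGm : Measurable (Function.uncurry G) := Measurable.ite hR hF measurable_const
  have h1 : ∫⁻ s in A, ∫⁻ y in B s, F s y = ∫⁻ s, ∫⁻ y, G s y := by
    rw [← lintegral_indicator hA]
    refine lintegral_congr fun s => ?_
    by_cases hs : s ∈ A
    · rw [Set.indicator_of_mem hs, ← lintegral_indicator (hB s)]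
      simp [hG, Set.indicator, hs]
    · simp [hG, hs]
  have h2 : ∫⁻ y in A', ∫⁻ s in B' y, F s y = ∫⁻ y, ∫⁻ s, G s y := by
    rw [← lintegral_indicator hA']
    refine lintegral_congr fun y => ?_
    by_cases hy : y ∈ A'
    · rw [Set.indicator_of_mem hy, ← lintegral_indicator (hB' y)]
      simp [hG, Set.indicator, hy, h]
    · simp [hG, hy, h]
  rw [h1, h2, lintegral_lintegral_swap hGm.aemeasurable]

theorem setLIntegral_Ioo_sub (a b s : ℝ) (f : ℝ → ℝ≥0∞) :
    ∫⁻ x in Set.Ioo a b, f x = ∫⁻ y in Set.Ioo (a + s) (b + s), f (y - s) := by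
  have h := measurePreserving_sub_right (volume : Measure ℝ) s
  rw [← h.setLIntegral_comp_preimage_emb (MeasurableEquiv.subRight s).measurableEmbedding]
  simp

theorem setLIntegral_ofReal_eq_sub {F f : ℝ → ℝ} {a b : ℝ} (hab : a ≤ b)
    (hF : ∀ s, HasDerivAt F (f s) s) (hc : Continuous f) (h0 : ∀ s ∈ Set.Ioo a b, 0 ≤ f s) :
    ∫⁻ s in Set.Ioo a b, ENNReal.ofReal (f s) = ENNReal.ofReal (F b - F a) := by
  rw [← intervalIntegral.integral_eq_sub_of_hasDerivAt (fun s _ => hF s)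
    (hc.intervalIntegrable a b), intervalIntegral.integral_of_le hab, integral_Ioc_eq_integral_Ioo,
    ofReal_integral_eq_lintegral_ofReal]
  · exact hc.integrableOn_Icc.mono_set Set.Ioo_subset_Icc_self
  · exact (ae_restrict_iff' measurableSet_Ioo).2 (Eventually.of_forall h0)

theorem setLIntegral_ofReal_eq_ofReal {f : ℝ → ℝ} {b : ℝ} (hb : 0 ≤ b)
    (hc : Continuous f) (h0 : ∀ s ∈ Set.Ioo 0 b, 0 ≤ f s) :
    ∫⁻ s in Set.Ioo 0 b, ENNReal.ofReal (f s) = ENNReal.ofReal (∫ s in (0 : ℝ)..b, f s) := by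
  rw [intervalIntegral.integral_of_le hb, integral_Ioc_eq_integral_Ioo,
    ofReal_integral_eq_lintegral_ofReal]
  · exact hc.integrableOn_Icc.mono_set Set.Ioo_subset_Icc_self
  · exact (ae_restrict_iff' measurableSet_Ioo).2 (Eventually.of_forall h0)

/-- The running maximum over `[0, t]` with `n` uniformly distributed reversal times and initial
velocity `-1` has an atom at `0` and a density on `(0, t)`, given up to the factor `t ^ n / n!` by
`z t` and `u t`. -/
def HasMaxLawNeg (n : ℕ) (z : ℝ → ℝ) (u : ℝ → ℝ → ℝ) : Prop :=
  ∀ t, 0 < t → ∀ g : ℝ → ℝ≥0∞, Measurable g → maxIntegral (-1) n t g =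
    (n ! : ℝ≥0∞) * (ENNReal.ofReal (z t) * g 0 + ∫⁻ x in Set.Ioo 0 t, ENNReal.ofReal (u t x) * g x)

/-- The running maximum over `[0, t]` with `n` uniformly distributed reversal times and initial
velocity `1` has a density on `(0, t)`, given up to the factor `t ^ n / n!` by `w t`. -/
def HasMaxLawPos (n : ℕ) (w : ℝ → ℝ → ℝ) : Prop :=
  ∀ t, 0 < t → ∀ g : ℝ → ℝ≥0∞, Measurable g → maxIntegral 1 n t g =
    (n ! : ℝ≥0∞) * ∫⁻ x in Set.Ioo 0 t, ENNReal.ofReal (w t x) * g x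

/-- The maximum is `s + X` with `X` from a downward path of length `t - s`. The value `y` arises
from the atom of `X` when `s = y`, with weight `z (t - y)`, or from the density of `X` at `y - s`
for some `s < y`. The hypothesis `hw` says that these contributions add up to `w t y`. -/
theorem HasMaxLawNeg.pos_succ {n : ℕ} {z : ℝ → ℝ} {u w : ℝ → ℝ → ℝ} (h : HasMaxLawNeg n z u)
    (hz : Continuous z) (hu : Continuous (Function.uncurry u))
    (hw : ∀ y t, 0 < y → y < t → ENNReal.ofReal (z (t - y)) +
      ∫⁻ s in Set.Ioo 0 y, ENNReal.ofReal (u (t - s) (y - s)) = ENNReal.ofReal (w t y)) :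
    HasMaxLawPos (n + 1) w := by
  intro t ht g hg
  have hu2 : Measurable fun p : ℝ × ℝ => ENNReal.ofReal (u (t - p.1) (p.2 - p.1)) :=
    ENNReal.measurable_ofReal.comp (hu.comp (f := fun p : ℝ × ℝ => (t - p.1, p.2 - p.1))
      (by fun_prop)).measurable
  rw [maxIntegral_one_succ n ht hg, setLIntegral_congr Ioo_ae_eq_Ioc.symm]
  have h1 : ∫⁻ s in Set.Ioo 0 t, maxIntegral (-1) n (t - s) (fun x => g (s + x)) =
      ∫⁻ s in Set.Ioo 0 t, (n ! : ℝ≥0∞) * (ENNReal.ofReal (z (t - s)) * g s +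
        ∫⁻ y in Set.Ioo s t, ENNReal.ofReal (u (t - s) (y - s)) * g y) := by
    refine setLIntegral_congr_fun measurableSet_Ioo fun s hs => ?_
    rw [h _ (sub_pos.2 hs.2) (fun x => g (s + x)) (hg.comp (measurable_const_add s)), setLIntegral_Ioo_sub _ _ s]
    simp
  have h2 : ∫⁻ s in Set.Ioo 0 t, ∫⁻ y in Set.Ioo s t, ENNReal.ofReal (u (t - s) (y - s)) * g y =
      ∫⁻ y in Set.Ioo 0 t, ∫⁻ s in Set.Ioo 0 y, ENNReal.ofReal (u (t - s) (y - s)) * g y := by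
    refine lintegral_lintegral_swap_of_mem_iff measurableSet_Ioo measurableSet_Ioo
      (fun _ => measurableSet_Ioo) (fun _ => measurableSet_Ioo) ?_ ?_ ?_
    · have : {p : ℝ × ℝ | p.1 ∈ Set.Ioo 0 t ∧ p.2 ∈ Set.Ioo p.1 t} =
          {p | 0 < p.1} ∩ {p | p.1 < t} ∩ ({p | p.1 < p.2} ∩ {p | p.2 < t}) := by ext; rfl
      rw [this]
      exact ((measurableSet_lt measurable_const measurable_fst).inter
        (measurableSet_lt measurable_fst measurable_const)).inter
        ((measurableSet_lt measurable_fst measurable_snd).inter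
        (measurableSet_lt measurable_snd measurable_const))
    · intro s y
      simp only [Set.mem_Ioo]
      constructor
      · rintro ⟨⟨_, _⟩, _, _⟩; refine ⟨⟨?_, ?_⟩, ?_, ?_⟩ <;> linarith
      · rintro ⟨⟨_, _⟩, _, _⟩; refine ⟨⟨?_, ?_⟩, ?_, ?_⟩ <;> linarith
    · exact hu2.mul (hg.comp measurable_snd)
  have hzm : Measurable fun s => ENNReal.ofReal (z (t - s)) * g s :=
    (ENNReal.measurable_ofReal.comp (hz.comp (f := fun s => t - s) (by fun_prop)).measurable).mul hg
  rw [h1, lintegral_const_mul' _ _ (ENNReal.natCast_ne_top _), lintegral_add_left hzm, h2,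
    ← lintegral_add_left hzm, ← mul_assoc, Nat.factorial_succ, Nat.cast_mul]
  congr 1
  refine setLIntegral_congr_fun measurableSet_Ioo fun y hy => ?_
  have hm : Measurable fun s => ENNReal.ofReal (u (t - s) (y - s)) :=
    hu2.comp (measurable_id.prodMk measurable_const)
  rw [lintegral_mul_const _ hm, ← add_mul,
    hw y t hy.1 hy.2]

/-- The maximum is `max 0 (X - s)` with `X` from an upward path of length `t - s`. A value `y > 0`
needs `X = y + s < t - s`, that is `s < (t - y) / 2`; all cases with `X ≤ s` collapse to the atom.
The weight of the atom is not computed directly but deduced from the total mass in `hz`. -/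
theorem HasMaxLawPos.neg_succ {n : ℕ} {z : ℝ → ℝ} {u w : ℝ → ℝ → ℝ} (h : HasMaxLawPos n w)
    (hw : Continuous (Function.uncurry w))
    (hu : ∀ y t, 0 < y → y < t →
      ∫⁻ s in Set.Ioo 0 ((t - y) / 2), ENNReal.ofReal (w (t - s) (y + s)) = ENNReal.ofReal (u t y))
    (hz : ∀ t, 0 < t → ENNReal.ofReal (z t) + ∫⁻ x in Set.Ioo 0 t, ENNReal.ofReal (u t x) =
      ENNReal.ofReal (t ^ (n + 1) / (n + 1)!)) :
    HasMaxLawNeg (n + 1) z u := by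
  intro t ht
  have hw2 : Measurable fun p : ℝ × ℝ => ENNReal.ofReal (w (t - p.1) (p.2 + p.1)) :=
    ENNReal.measurable_ofReal.comp (hw.comp (f := fun p : ℝ × ℝ => (t - p.1, p.2 + p.1))
      (by fun_prop)).measurable
  have hw1 : ∀ τ, Measurable fun x => ENNReal.ofReal (w τ x) := fun τ =>
    ENNReal.measurable_ofReal.comp (hw.comp (f := fun x => (τ, x)) (by fun_prop)).measurable
  -- `Z` is the still unevaluated weight of the event `X ≤ s`; the point is that it does not depend
  -- on `g`.
  obtain ⟨Z, hZ⟩ : ∃ Z : ℝ≥0∞, ∀ g : ℝ → ℝ≥0∞, Measurable g → maxIntegral (-1) (n + 1) t g =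
      ((n + 1)! : ℝ≥0∞) * (Z * g 0 + ∫⁻ x in Set.Ioo 0 t, ENNReal.ofReal (u t x) * g x) := by
    refine ⟨∫⁻ s in Set.Ioo 0 t, ∫⁻ x in Set.Ioo 0 (t - s) ∩ Set.Iic s,
      ENNReal.ofReal (w (t - s) x), fun g hg => ?_⟩
    rw [maxIntegral_neg_one_succ n ht hg, setLIntegral_congr Ioo_ae_eq_Ioc.symm]
    have h1 : ∫⁻ s in Set.Ioo 0 t, maxIntegral 1 n (t - s) (fun x => g (max 0 (x - s))) =
        ∫⁻ s in Set.Ioo 0 t, (n ! : ℝ≥0∞) * ((∫⁻ x in Set.Ioo 0 (t - s) ∩ Set.Iic s,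
          ENNReal.ofReal (w (t - s) x)) * g 0 +
          ∫⁻ y in Set.Ioo 0 (t - 2 * s), ENNReal.ofReal (w (t - s) (y + s)) * g y) := by
      refine setLIntegral_congr_fun measurableSet_Ioo fun s hs => ?_
      rw [h _ (sub_pos.2 hs.2) (fun x => g (max 0 (x - s))) (hg.comp (by fun_prop))]
      congr 1
      rw [← lintegral_inter_add_sdiff _ _ (measurableSet_Iic (a := s)),
        ← lintegral_mul_const _ (hw1 _)]
      congr 1
      · refine setLIntegral_congr_fun (measurableSet_Ioo.inter measurableSet_Iic) fun x hx => ?_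
        have : x - s ≤ 0 := sub_nonpos.2 hx.2
        simp only [max_eq_left this]
      · have : Set.Ioo 0 (t - s) \ Set.Iic s = Set.Ioo s (t - s) := by
          ext x
          simp only [Set.mem_sdiff, Set.mem_Ioo, Set.mem_Iic, not_le]
          exact ⟨fun hx => ⟨hx.2, hx.1.2⟩, fun hx => ⟨⟨hs.1.trans hx.1, hx.2⟩, hx.1⟩⟩
        rw [this, setLIntegral_Ioo_sub _ _ (-s)]
        have h3 : s + -s = 0 := by ring
        have h4 : t - s + -s = t - 2 * s := by ring
        rw [h3, h4]
        refine setLIntegral_congr_fun measurableSet_Ioo fun y hy => ?_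
        simp [hy.1.le]
    have h2 : ∫⁻ s in Set.Ioo 0 t, ∫⁻ y in Set.Ioo 0 (t - 2 * s),
          ENNReal.ofReal (w (t - s) (y + s)) * g y =
        ∫⁻ y in Set.Ioo 0 t, ∫⁻ s in Set.Ioo 0 ((t - y) / 2),
          ENNReal.ofReal (w (t - s) (y + s)) * g y := by
      refine lintegral_lintegral_swap_of_mem_iff measurableSet_Ioo measurableSet_Ioo
        (fun _ => measurableSet_Ioo) (fun _ => measurableSet_Ioo) ?_ ?_ ?_
      · have : {p : ℝ × ℝ | p.1 ∈ Set.Ioo 0 t ∧ p.2 ∈ Set.Ioo 0 (t - 2 * p.1)} =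
            {p | 0 < p.1} ∩ {p | p.1 < t} ∩ ({p | 0 < p.2} ∩ {p | p.2 < t - 2 * p.1}) := by
          ext; rfl
        rw [this]
        exact ((measurableSet_lt measurable_const measurable_fst).inter
          (measurableSet_lt measurable_fst measurable_const)).inter
          ((measurableSet_lt measurable_const measurable_snd).inter
          (measurableSet_lt measurable_snd (by fun_prop)))
      · intro s y
        simp only [Set.mem_Ioo]
        constructor
        · rintro ⟨⟨_, _⟩, _, _⟩; refine ⟨⟨?_, ?_⟩, ?_, ?_⟩ <;> linarith
        · rintro ⟨⟨_, _⟩, _, _⟩; refine ⟨⟨?_, ?_⟩, ?_, ?_⟩ <;> linarith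
      · exact hw2.mul (hg.comp measurable_snd)
    have hm2 : Measurable fun s => ∫⁻ y in Set.Ioo 0 (t - 2 * s),
        ENNReal.ofReal (w (t - s) (y + s)) * g y := by
      have : (fun s => ∫⁻ y in Set.Ioo 0 (t - 2 * s), ENNReal.ofReal (w (t - s) (y + s)) * g y) =
          fun s => ∫⁻ y, (({p | 0 < p.2} ∩ {p | p.2 < t - 2 * p.1} : Set (ℝ × ℝ)).indicator
            (fun p => ENNReal.ofReal (w (t - p.1) (p.2 + p.1)) * g p.2)) (s, y) := by
        ext s
        rw [← lintegral_indicator measurableSet_Ioo]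
        rfl
      rw [this]
      refine Measurable.lintegral_prod_right' (Measurable.indicator ?_ ?_)
      · exact hw2.mul (hg.comp measurable_snd)
      · exact (measurableSet_lt measurable_const measurable_snd).inter
          (measurableSet_lt measurable_snd (by fun_prop))
    have hm1 : Measurable fun s => ∫⁻ x in Set.Ioo 0 (t - s) ∩ Set.Iic s,
        ENNReal.ofReal (w (t - s) x) := by
      have : (fun s => ∫⁻ x in Set.Ioo 0 (t - s) ∩ Set.Iic s, ENNReal.ofReal (w (t - s) x)) =
          fun s => ∫⁻ x, (({p | 0 < p.2} ∩ {p | p.2 < t - p.1} ∩ {p | p.2 ≤ p.1} :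
            Set (ℝ × ℝ)).indicator (fun p => ENNReal.ofReal (w (t - p.1) p.2))) (s, x) := by
        ext s
        rw [← lintegral_indicator (measurableSet_Ioo.inter measurableSet_Iic)]
        rfl
      rw [this]
      refine Measurable.lintegral_prod_right' (Measurable.indicator ?_ ?_)
      · exact ENNReal.measurable_ofReal.comp
          (hw.comp (f := fun p : ℝ × ℝ => (t - p.1, p.2)) (by fun_prop)).measurable
      · exact ((measurableSet_lt measurable_const measurable_snd).inter
          (measurableSet_lt measurable_snd (by fun_prop))).inter
          (measurableSet_le measurable_snd measurable_fst)
    rw [h1, lintegral_const_mul' _ _ (ENNReal.natCast_ne_top _), lintegral_add_right _ hm2, h2,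
      lintegral_mul_const _ hm1, ← mul_assoc, Nat.factorial_succ, Nat.cast_mul]
    congr 2
    refine setLIntegral_congr_fun measurableSet_Ioo fun y hy => ?_
    have hm : Measurable fun s => ENNReal.ofReal (w (t - s) (y + s)) :=
      hw2.comp (measurable_id.prodMk measurable_const)
    rw [lintegral_mul_const _ hm, hu y t hy.1 hy.2]
  -- Testing against `g = 1` compares `Z` with `z t`; cancellation in `ℝ≥0∞` is legitimate because
  -- the density has finite integral, bounded by the total mass.
  have hZz : Z = ENNReal.ofReal (z t) := by
    have h1 := hZ (fun _ => 1) measurable_const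
    simp only [mul_one] at h1
    have h2 := hz t ht
    have hf : ((n + 1)! : ℝ) ≠ 0 := by positivity
    have h3 : ENNReal.ofReal t ^ (n + 1) =
        ((n + 1)! : ℝ≥0∞) * ENNReal.ofReal (t ^ (n + 1) / (n + 1)!) := by
      rw [← ENNReal.ofReal_natCast, ← ENNReal.ofReal_mul (by positivity), mul_div_cancel₀ _ hf,
        ENNReal.ofReal_pow ht.le]
    rw [maxIntegral_const_one, h3, ← h2] at h1
    have h4 := (ENNReal.mul_right_inj (by positivity) (ENNReal.natCast_ne_top _)).1 h1
    refine ((ENNReal.add_left_inj ?_).1 h4).symm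
    refine ne_top_of_le_ne_top (b := ENNReal.ofReal (t ^ (n + 1) / (n + 1)!)) ENNReal.ofReal_ne_top
      (le_of_le_of_eq ?_ h2)
    exact le_add_self
  intro g hg
  rw [hZ g hg, hZz]

/-! ### The explicit densities and their identities. -/

/-- The normalising constant `1 / (4 ^ k * k! ^ 2)`. -/
noncomputable def lawConst (k : ℕ) : ℝ := 1 / (4 ^ k * (k ! : ℝ) ^ 2)

theorem lawConst_pos (k : ℕ) : 0 < lawConst k := by unfold lawConst; positivity

theorem lawConst_succ (k : ℕ) : lawConst (k + 1) = lawConst k / (4 * ((k : ℝ) + 1) ^ 2) := by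
  unfold lawConst
  rw [Nat.factorial_succ]
  push_cast
  field_simp
  ring

/-- The unnormalised density for initial velocity `-1` and `2 k` reversals. -/
noncomputable def negEven (k : ℕ) (t x : ℝ) : ℝ :=
  2 * lawConst k * (t - x) ^ k * (k * (t + x) ^ (k - 1))

/-- The unnormalised density for initial velocity `1` and `2 k + 1` reversals. -/
noncomputable def posOdd (k : ℕ) (t x : ℝ) : ℝ := lawConst k * (t - x) ^ k * (t + x) ^ k

/-- The unnormalised density for initial velocity `-1` and `2 k + 1` reversals. -/
noncomputable def negOdd (k : ℕ) (t x : ℝ) : ℝ :=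
  lawConst k / (2 * k + 2) * (t - x) ^ k * (k * (t - x) * (t + x) ^ (k - 1) + (k + 1) * (t + x) ^ k)

/-- The unnormalised density for initial velocity `1` and `2 k + 2` reversals. -/
noncomputable def posEven (k : ℕ) (t x : ℝ) : ℝ :=
  lawConst k / (2 * k + 2) * t * (t - x) ^ k * (t + x) ^ k

/-- The factor `t / (2 * k + 2)` is exactly the change of normalisation from `2 k + 1` to `2 k + 2`
points, so the two conditional laws coincide. -/
theorem posEven_eq (k : ℕ) (t x : ℝ) : posEven k t x = t / (2 * k + 2) * posOdd k t x := by
  unfold posEven posOdd; ring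

/-- After normalisation the weights become `(2 k + 1) / (2 k + 2)` and `1 / (2 k + 2)`: this is the
mixture in part 4. -/
theorem negOdd_eq (k : ℕ) (t x : ℝ) :
    negOdd k t x = t / (2 * k + 2) * negEven k t x + 1 / (2 * k + 2) * posOdd k t x := by
  unfold negOdd negEven posOdd
  have : (2 * (k : ℝ) + 2) ≠ 0 := by positivity
  cases k with
  | zero => simp; ring
  | succ k => simp only [Nat.add_sub_cancel]; push_cast; ring

/-- Reduces every integral of `negEven` to integrals of `posOdd` against one more power of `x`. -/
theorem negEven_succ (k : ℕ) (t x : ℝ) :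
    negEven (k + 1) t x = 1 / (2 * k + 2) * (t - x) * posOdd k t x := by
  unfold negEven posOdd
  rw [lawConst_succ]
  have : ((k : ℝ) + 1) ≠ 0 := by positivity
  simp only [Nat.add_sub_cancel]
  push_cast
  field_simp
  ring

theorem continuous_posOdd (k : ℕ) : Continuous (Function.uncurry (posOdd k)) := by
  unfold posOdd Function.uncurry; fun_prop

theorem continuous_posEven (k : ℕ) : Continuous (Function.uncurry (posEven k)) := by
  unfold posEven Function.uncurry; fun_prop

theorem continuous_negEven (k : ℕ) : Continuous (Function.uncurry (negEven k)) := by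
  unfold negEven Function.uncurry; fun_prop

theorem continuous_negOdd (k : ℕ) : Continuous (Function.uncurry (negOdd k)) := by
  unfold negOdd Function.uncurry; fun_prop

theorem posOdd_nonneg (k : ℕ) {t x : ℝ} (hx : x ∈ Set.Ioo 0 t) : 0 ≤ posOdd k t x := by
  have h1 : 0 ≤ t - x := sub_nonneg.2 hx.2.le
  have h2 : 0 ≤ t + x := by linarith [hx.1]
  have := lawConst_pos k
  unfold posOdd; positivity

theorem posEven_nonneg (k : ℕ) {t x : ℝ} (hx : x ∈ Set.Ioo 0 t) : 0 ≤ posEven k t x := by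
  have h1 : 0 ≤ t := (hx.1.trans hx.2).le
  have := posOdd_nonneg k hx
  rw [posEven_eq]; positivity

theorem negEven_nonneg (k : ℕ) {t x : ℝ} (hx : x ∈ Set.Ioo 0 t) : 0 ≤ negEven k t x := by
  have h1 : 0 ≤ t - x := sub_nonneg.2 hx.2.le
  have h2 : 0 ≤ t + x := by linarith [hx.1]
  have := lawConst_pos k
  unfold negEven; positivity

theorem negOdd_nonneg (k : ℕ) {t x : ℝ} (hx : x ∈ Set.Ioo 0 t) : 0 ≤ negOdd k t x := by
  have h1 : 0 ≤ t := (hx.1.trans hx.2).le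
  have := posOdd_nonneg k hx
  have := negEven_nonneg k hx
  rw [negOdd_eq]; positivity

theorem hasDerivAt_const_sub_two_mul_pow (a s : ℝ) (k : ℕ) :
    HasDerivAt (fun s : ℝ => (a - 2 * s) ^ k) (k * (a - 2 * s) ^ (k - 1) * (-2)) s := by
  have h : HasDerivAt (fun s : ℝ => a - 2 * s) (-2) s := by
    simpa using ((hasDerivAt_id s).const_mul 2).const_sub a
  exact h.pow k

/-- The normalisation is read off from the volume of the cube, so no Beta integral has to be
evaluated here. -/
theorem HasMaxLawPos.integral_eq {n : ℕ} {w : ℝ → ℝ → ℝ} (h : HasMaxLawPos n w)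
    (hw : Continuous (Function.uncurry w)) (h0 : ∀ t, ∀ x ∈ Set.Ioo 0 t, 0 ≤ w t x) {t : ℝ}
    (ht : 0 < t) : ∫ x in (0 : ℝ)..t, w t x = t ^ n / n ! := by
  have hc : Continuous (w t) := hw.comp (f := fun x => (t, x)) (by fun_prop)
  have h1 := h t ht (fun _ => 1) measurable_const
  simp only [mul_one] at h1
  rw [maxIntegral_const_one, setLIntegral_ofReal_eq_ofReal ht.le hc (h0 t),
    ← ENNReal.ofReal_pow ht.le, ← ENNReal.ofReal_natCast, ← ENNReal.ofReal_mul (by positivity)] at h1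
  have h2 : 0 ≤ ∫ x in (0 : ℝ)..t, w t x := by
    rw [intervalIntegral.integral_of_le ht.le, integral_Ioc_eq_integral_Ioo]
    exact setIntegral_nonneg measurableSet_Ioo (h0 t)
  have h3 := (ENNReal.ofReal_eq_ofReal_iff (by positivity) (by positivity)).1 h1
  rw [h3]
  field_simp

theorem integral_mul_posOdd (k : ℕ) (t : ℝ) :
    ∫ x in (0 : ℝ)..t, x * posOdd k t x = lawConst k * t ^ (2 * k + 2) / (2 * k + 2) := by
  have hd : ∀ x ∈ Set.uIcc 0 t, HasDerivAt (fun x : ℝ => -(lawConst k / (2 * k + 2)) *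
      (t ^ 2 - x ^ 2) ^ (k + 1)) (x * posOdd k t x) x := by
    intro x _
    have h1 : HasDerivAt (fun x : ℝ => t ^ 2 - x ^ 2) (-(2 * x)) x := by
      simpa using (hasDerivAt_pow 2 x).const_sub (t ^ 2)
    refine ((h1.pow (k + 1)).const_mul (-(lawConst k / (2 * k + 2)))).congr_deriv ?_
    have : (2 * (k : ℝ) + 2) ≠ 0 := by positivity
    simp only [Nat.add_sub_cancel, posOdd, mul_assoc]
    rw [← mul_pow, show t ^ 2 - x ^ 2 = (t - x) * (t + x) by ring]
    push_cast
    field_simp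
  rw [intervalIntegral.integral_eq_sub_of_hasDerivAt hd]
  · simp
    ring
  · refine Continuous.intervalIntegrable ?_ _ _
    unfold posOdd; fun_prop

theorem ofReal_add_setLIntegral {u : ℝ → ℝ} {z t M : ℝ} (ht : 0 < t) (hz : 0 ≤ z)
    (hu : Continuous u) (h0 : ∀ x ∈ Set.Ioo 0 t, 0 ≤ u x)
    (h : ∫ x in (0 : ℝ)..t, u x = M - z) :
    ENNReal.ofReal z + ∫⁻ x in Set.Ioo 0 t, ENNReal.ofReal (u x) = ENNReal.ofReal M := by
  have h2 : 0 ≤ ∫ x in (0 : ℝ)..t, u x := by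
    rw [intervalIntegral.integral_of_le ht.le, integral_Ioc_eq_integral_Ioo]
    exact setIntegral_nonneg measurableSet_Ioo h0
  rw [setLIntegral_ofReal_eq_ofReal ht.le hu h0, ← ENNReal.ofReal_add hz h2, h]
  congr 1
  ring

/-! ### The laws of the maximum, by induction on the number of reversals. -/

/-- Without reversals a downward path never exceeds `0`: the law is the atom alone, and `negEven 0`
vanishes through its factor `k`, whatever the truncated exponent `k - 1`. -/
theorem hasMaxLawNeg_zero : HasMaxLawNeg (2 * 0) (fun t => lawConst 0 * t ^ (2 * 0)) (negEven 0) := by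
  intro t ht g _
  rw [mul_zero, maxIntegral_zero, runMax_neg_one ht.le]
  simp [lawConst, negEven]

/-- Under the shift by `s`, the difference `t - y` stays fixed and the sum becomes `t + y - 2 s`, so
the integrand is an exact derivative in `s`. Its boundary term at `s = y` cancels the atom `lawConst
k * (t - y) ^ (2 * k)`, and the one at `s = 0` is `posOdd k t y`. -/
theorem HasMaxLawNeg.posOdd {k : ℕ}
    (h : HasMaxLawNeg (2 * k) (fun t => lawConst k * t ^ (2 * k)) (negEven k)) :
    HasMaxLawPos (2 * k + 1) (posOdd k) := by
  refine h.pos_succ (by fun_prop) (continuous_negEven k) fun y t hy hyt => ?_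
  have hC := lawConst_pos k
  have hp : 0 < t - y := sub_pos.2 hyt
  rw [setLIntegral_ofReal_eq_sub (F := fun s => -(lawConst k * (t - y) ^ k) * (t + y - 2 * s) ^ k)
    hy.le]
  · rw [← ENNReal.ofReal_add (by positivity)]
    · unfold _root_.posOdd
      congr 1
      simp only [mul_zero, sub_zero, two_mul, pow_add]
      ring
    · have : (t + y - 2 * y) ^ k ≤ (t + y - 2 * 0) ^ k := by gcongr; linarith
      have h2 : 0 ≤ lawConst k * (t - y) ^ k := by positivity
      nlinarith
  · intro s
    refine ((hasDerivAt_const_sub_two_mul_pow (t + y) s k).const_mul _).congr_deriv ?_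
    unfold negEven
    rw [show t - s - (y - s) = t - y by ring, show t - s + (y - s) = t + y - 2 * s by ring]
    ring
  · exact (continuous_negEven k).comp (f := fun s => (t - s, y - s)) (by fun_prop)
  · intro s hs
    exact negEven_nonneg k ⟨by linarith [hs.2], by linarith⟩

/-- Here the sum `t + y` stays fixed and the difference becomes `t - y - 2 s`, which vanishes at the
upper limit, so only the boundary term at `s = 0` survives. The total mass needs just the integral
and the first moment of `posOdd`. -/
theorem HasMaxLawPos.negEven_succ {k : ℕ} (h : HasMaxLawPos (2 * k + 1) (posOdd k)) :
    HasMaxLawNeg (2 * (k + 1)) (fun t => lawConst (k + 1) * t ^ (2 * (k + 1)))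
      (negEven (k + 1)) := by
  refine h.neg_succ (continuous_posOdd k) (fun y t hy hyt => ?_) fun t ht => ?_
  · have hp : 0 < t - y := sub_pos.2 hyt
    rw [setLIntegral_ofReal_eq_sub
      (F := fun s => -(lawConst k * (t + y) ^ k / (2 * k + 2)) * (t - y - 2 * s) ^ (k + 1))
      (by positivity)]
    · congr 1
      rw [_root_.negEven_succ]
      unfold posOdd
      have : t - y - 2 * ((t - y) / 2) = 0 := by ring
      simp only [this, mul_zero, sub_zero, pow_succ]
      ring
    · intro s
      refine ((hasDerivAt_const_sub_two_mul_pow (t - y) s (k + 1)).const_mul _).congr_deriv ?_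
      unfold posOdd
      rw [show t - s - (y + s) = t - y - 2 * s by ring, show t - s + (y + s) = t + y by ring]
      simp only [Nat.add_sub_cancel]
      have : (2 * (k : ℝ) + 2) ≠ 0 := by positivity
      push_cast
      field_simp
    · exact (continuous_posOdd k).comp (f := fun s => (t - s, y + s)) (by fun_prop)
    · intro s hs
      exact posOdd_nonneg k ⟨by linarith [hs.1], by linarith [hs.2]⟩
  · have hC := lawConst_pos (k + 1)
    refine ofReal_add_setLIntegral ht (by positivity)
      ((continuous_negEven (k + 1)).comp (f := fun x => (t, x)) (by fun_prop))
      (fun x hx => negEven_nonneg _ hx) ?_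
    have hc : Continuous (posOdd k t) :=
      (continuous_posOdd k).comp (f := fun x => (t, x)) (by fun_prop)
    have h1 := h.integral_eq (continuous_posOdd k) (fun t x hx => posOdd_nonneg k hx) ht
    have h2 := integral_mul_posOdd k t
    have h3 : ∀ x, negEven (k + 1) t x =
        t / (2 * k + 2) * posOdd k t x - 1 / (2 * k + 2) * (x * posOdd k t x) := fun x => by
      rw [_root_.negEven_succ]; ring
    simp_rw [h3]
    rw [intervalIntegral.integral_sub (Continuous.intervalIntegrable (by fun_prop) _ _)
      (Continuous.intervalIntegrable (by fun_prop) _ _), intervalIntegral.integral_const_mul,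
      intervalIntegral.integral_const_mul, h1, h2, lawConst_succ, Nat.factorial_succ (2 * k + 1)]
    have : (k : ℝ) + 1 ≠ 0 := by positivity
    have h5 : 2 * (k : ℝ) + 1 + 1 = 2 * ((k : ℝ) + 1) := by ring
    have h6 : 2 * (k : ℝ) + 2 = 2 * ((k : ℝ) + 1) := by ring
    push_cast
    rw [h5, h6]
    field_simp
    ring

theorem hasMaxLawNeg_even (k : ℕ) :
    HasMaxLawNeg (2 * k) (fun t => lawConst k * t ^ (2 * k)) (negEven k) := by
  induction k with
  | zero => exact hasMaxLawNeg_zero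
  | succ k ih => exact ih.posOdd.negEven_succ

theorem hasMaxLawPos_odd (k : ℕ) : HasMaxLawPos (2 * k + 1) (posOdd k) :=
  (hasMaxLawNeg_even k).posOdd

theorem integral_posOdd (k : ℕ) {t : ℝ} (ht : 0 < t) :
    ∫ x in (0 : ℝ)..t, posOdd k t x = t ^ (2 * k + 1) / (2 * k + 1)! :=
  (hasMaxLawPos_odd k).integral_eq (continuous_posOdd k) (fun _ _ hx => posOdd_nonneg k hx) ht

theorem integral_negEven (k : ℕ) {t : ℝ} (ht : 0 < t) :
    ∫ x in (0 : ℝ)..t, negEven k t x = t ^ (2 * k) / (2 * k)! - lawConst k * t ^ (2 * k) := by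
  cases k with
  | zero => simp [negEven, lawConst]
  | succ k =>
    have hc : Continuous (posOdd k t) :=
      (continuous_posOdd k).comp (f := fun x => (t, x)) (by fun_prop)
    have h3 : ∀ x, negEven (k + 1) t x =
        t / (2 * k + 2) * posOdd k t x - 1 / (2 * k + 2) * (x * posOdd k t x) := fun x => by
      rw [_root_.negEven_succ]; ring
    simp_rw [h3]
    rw [intervalIntegral.integral_sub (Continuous.intervalIntegrable (by fun_prop) _ _)
      (Continuous.intervalIntegrable (by fun_prop) _ _), intervalIntegral.integral_const_mul,
      intervalIntegral.integral_const_mul, integral_posOdd k ht, integral_mul_posOdd,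
      lawConst_succ, show 2 * (k + 1) = 2 * k + 1 + 1 by ring, Nat.factorial_succ (2 * k + 1)]
    have : (k : ℝ) + 1 ≠ 0 := by positivity
    have h5 : 2 * (k : ℝ) + 1 + 1 = 2 * ((k : ℝ) + 1) := by ring
    have h6 : 2 * (k : ℝ) + 2 = 2 * ((k : ℝ) + 1) := by ring
    push_cast
    rw [h5, h6]
    field_simp
    ring

theorem integral_negOdd (k : ℕ) {t : ℝ} (ht : 0 < t) :
    ∫ x in (0 : ℝ)..t, negOdd k t x =
      t ^ (2 * k + 1) / (2 * k + 1)! - lawConst k / (2 * k + 2) * t ^ (2 * k + 1) := by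
  have hc : Continuous (posOdd k t) :=
    (continuous_posOdd k).comp (f := fun x => (t, x)) (by fun_prop)
  have hc' : Continuous (negEven k t) :=
    (continuous_negEven k).comp (f := fun x => (t, x)) (by fun_prop)
  simp_rw [negOdd_eq]
  rw [intervalIntegral.integral_add (Continuous.intervalIntegrable (by fun_prop) _ _)
    (Continuous.intervalIntegrable (by fun_prop) _ _), intervalIntegral.integral_const_mul,
    intervalIntegral.integral_const_mul, integral_posOdd k ht, integral_negEven k ht,
    Nat.factorial_succ (2 * k)]
  have h6 : 2 * (k : ℝ) + 2 ≠ 0 := by positivity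
  push_cast
  field_simp
  ring

theorem continuous_negOdd_apply (k : ℕ) (t : ℝ) : Continuous (negOdd k t) :=
  (continuous_negOdd k).comp (f := fun x => (t, x)) (by fun_prop)

/-- The odd chain needs its own start: an upward path without reversals has the deterministic
maximum `t`, which has no density. With one reversal at `s` the maximum is `max 0 (t - 2 s)`, so the
times `s ≥ t / 2` form the atom and the others give the constant density `1 / 2`. -/
theorem hasMaxLawNeg_one :
    HasMaxLawNeg (2 * 0 + 1) (fun t => lawConst 0 / (2 * (0 : ℕ) + 2) * t ^ (2 * 0 + 1))
      (negOdd 0) := by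
  intro t ht g hg
  have hu : ∀ x, negOdd 0 t x = 1 / 2 := fun x => by simp [negOdd, lawConst]
  have hz : lawConst 0 / (2 * (0 : ℕ) + 2) * t ^ (2 * 0 + 1) = t / 2 := by
    simp [lawConst]; ring
  rw [mul_zero, zero_add, maxIntegral_neg_one_succ 0 ht hg, setLIntegral_congr Ioo_ae_eq_Ioc.symm]
  simp_rw [maxIntegral_zero, hu, hz]
  have h1 : ∫⁻ s in Set.Ioo 0 t, g (max 0 (runMax (fun _ => 1) (t - s) - s)) =
      ∫⁻ s in Set.Ioo 0 t, g (max 0 (t - 2 * s)) := by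
    refine setLIntegral_congr_fun measurableSet_Ioo fun s hs => ?_
    rw [runMax_one (sub_nonneg.2 hs.2.le)]
    ring_nf
  have hU : Set.Ioo 0 t = Set.Ioo 0 (t / 2) ∪ Set.Ico (t / 2) t :=
    (Set.Ioo_union_Ico_eq_Ioo (by linarith) (by linarith)).symm
  have hD : Disjoint (Set.Ioo 0 (t / 2)) (Set.Ico (t / 2) t) := by
    rw [Set.disjoint_left]
    exact fun x hx hx' => hx.2.not_ge hx'.1
  have h2 : ∫⁻ s in Set.Ico (t / 2) t, g (max 0 (t - 2 * s)) = ENNReal.ofReal (t / 2) * g 0 := by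
    rw [setLIntegral_congr_fun (g := fun _ => g 0) measurableSet_Ico, lintegral_const,
      Measure.restrict_apply_univ, Real.volume_Ico, mul_comm]
    · congr 2; ring
    · intro s hs
      have : t - 2 * s ≤ 0 := by linarith [hs.1]
      simp [this]
  have himg : (fun s : ℝ => t - 2 * s) '' Set.Ioo 0 (t / 2) = Set.Ioo 0 t := by
    ext x
    constructor
    · rintro ⟨s, hs, rfl⟩
      exact ⟨by linarith [hs.2], by linarith [hs.1]⟩
    · intro hx
      exact ⟨(t - x) / 2, ⟨by linarith [hx.2], by linarith [hx.1]⟩, by ring⟩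
  have h3 : ∫⁻ s in Set.Ioo 0 (t / 2), g (max 0 (t - 2 * s)) =
      ∫⁻ x in Set.Ioo 0 t, ENNReal.ofReal (1 / 2) * g x := by
    have hd : ∀ s ∈ Set.Ioo 0 (t / 2),
        HasDerivWithinAt (fun s : ℝ => t - 2 * s) (-2) (Set.Ioo 0 (t / 2)) s := fun s _ => by
      simpa using (((hasDerivAt_id s).const_mul 2).const_sub t).hasDerivWithinAt
    have := lintegral_image_eq_lintegral_abs_deriv_mul measurableSet_Ioo hd
      (fun a _ b _ hab => by simpa using hab) fun x => ENNReal.ofReal (1 / 2) * g x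
    rw [himg] at this
    rw [this]
    refine setLIntegral_congr_fun measurableSet_Ioo fun s hs => ?_
    rw [← mul_assoc, ← ENNReal.ofReal_mul (by positivity), max_eq_right (by linarith [hs.2])]
    norm_num
  rw [h1, hU, lintegral_union measurableSet_Ico hD, h2, h3, ← hU]
  simp only [zero_add, Nat.factorial_one, Nat.cast_one, one_mul]
  exact add_comm _ _

theorem HasMaxLawNeg.posEven {k : ℕ}
    (h : HasMaxLawNeg (2 * k + 1) (fun t => lawConst k / (2 * k + 2) * t ^ (2 * k + 1))
      (negOdd k)) :
    HasMaxLawPos (2 * k + 2) (posEven k) := by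
  refine h.pos_succ (by fun_prop) (continuous_negOdd k) fun y t hy hyt => ?_
  have hC := lawConst_pos k
  have hp : 0 < t - y := sub_pos.2 hyt
  -- At `s = y` the two powers agree and cancel the atom; at `s = 0` the factor `(t - y) + (t + y) =
  -- 2 t` produces `posEven`.
  rw [setLIntegral_ofReal_eq_sub (F := fun s => -(lawConst k / (2 * k + 2) * (t - y) ^ k / 2) *
    ((t - y) * (t + y - 2 * s) ^ k + (t + y - 2 * s) ^ (k + 1))) hy.le]
  · rw [← ENNReal.ofReal_add (by positivity)]
    · unfold _root_.posEven
      congr 1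
      simp only [mul_zero, sub_zero, two_mul, pow_add]
      ring
    · have h0 : (t + y - 2 * y) ^ k ≤ (t + y - 2 * 0) ^ k := by gcongr; linarith
      have h1 : (t + y - 2 * y) ^ (k + 1) ≤ (t + y - 2 * 0) ^ (k + 1) := by gcongr; linarith
      have h2 : 0 ≤ lawConst k / (2 * k + 2) * (t - y) ^ k / 2 := by positivity
      have h3 := mul_le_mul_of_nonneg_left (add_le_add (mul_le_mul_of_nonneg_left h0 hp.le) h1) h2
      linarith
  · intro s
    refine (((hasDerivAt_const_sub_two_mul_pow (t + y) s k).const_mul (t - y)).add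
      (hasDerivAt_const_sub_two_mul_pow (t + y) s (k + 1))).const_mul _ |>.congr_deriv ?_
    unfold negOdd
    rw [show t - s - (y - s) = t - y by ring, show t - s + (y - s) = t + y - 2 * s by ring]
    simp only [Nat.add_sub_cancel]
    push_cast
    ring
  · exact (continuous_negOdd k).comp (f := fun s => (t - s, y - s)) (by fun_prop)
  · intro s hs
    exact negOdd_nonneg k ⟨by linarith [hs.2], by linarith⟩

theorem HasMaxLawPos.negOdd_succ {k : ℕ} (h : HasMaxLawPos (2 * k + 2) (posEven k)) :
    HasMaxLawNeg (2 * (k + 1) + 1)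
      (fun t => lawConst (k + 1) / (2 * (k + 1 : ℕ) + 2) * t ^ (2 * (k + 1) + 1))
      (negOdd (k + 1)) := by
  refine h.neg_succ (continuous_posEven k) (fun y t hy hyt => ?_) fun t ht => ?_
  · have hp : 0 < t - y := sub_pos.2 hyt
    have h1 : (k : ℝ) + 1 ≠ 0 := by positivity
    have h2 : (k : ℝ) + 2 ≠ 0 := by positivity
    rw [setLIntegral_ofReal_eq_sub (F := fun s => -(lawConst k / (2 * k + 2) * (t + y) ^ k / 4) *
      ((t - y - 2 * s) ^ (k + 2) / (k + 2) + (t + y) * (t - y - 2 * s) ^ (k + 1) / (k + 1)))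
      (by positivity)]
    · congr 1
      unfold negOdd
      rw [lawConst_succ]
      have : t - y - 2 * ((t - y) / 2) = 0 := by ring
      simp only [this, mul_zero, sub_zero, Nat.add_sub_cancel]
      push_cast
      rw [show 2 * ((k : ℝ) + 1) + 2 = 2 * (k + 2) by ring,
        show 2 * (k : ℝ) + 2 = 2 * (k + 1) by ring, show (k : ℝ) + 1 + 1 = k + 2 by ring]
      field_simp
      ring
    · intro s
      refine ((((hasDerivAt_const_sub_two_mul_pow (t - y) s (k + 2)).div_const _).add
        (((hasDerivAt_const_sub_two_mul_pow (t - y) s (k + 1)).const_mul (t + y)).div_const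
          _)).const_mul _).congr_deriv ?_
      unfold posEven
      -- The extra factor `t - s` of `posEven` is the mean of `t - y - 2 s` and the constant `t +
      -- y`; this explains the two powers in `F`.
      rw [show t - s - (y + s) = t - y - 2 * s by ring, show t - s + (y + s) = t + y by ring,
        show t - s = ((t - y - 2 * s) + (t + y)) / 2 by ring]
      simp only [Nat.add_sub_cancel, show k + 2 - 1 = k + 1 by omega]
      push_cast
      generalize t - y - 2 * s = p
      field_simp
      ring
    · exact (continuous_posEven k).comp (f := fun s => (t - s, y + s)) (by fun_prop)
    · intro s hs
      exact posEven_nonneg k ⟨by linarith [hs.1], by linarith [hs.2]⟩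
  · have hC := lawConst_pos (k + 1)
    refine ofReal_add_setLIntegral ht (by positivity) (continuous_negOdd_apply _ t)
      (fun x hx => negOdd_nonneg _ hx) ?_
    exact integral_negOdd (k + 1) ht

theorem hasMaxLawNeg_odd (k : ℕ) :
    HasMaxLawNeg (2 * k + 1) (fun t => lawConst k / (2 * k + 2) * t ^ (2 * k + 1)) (negOdd k) := by
  induction k with
  | zero => exact hasMaxLawNeg_one
  | succ k ih => exact ih.posEven.negOdd_succ

theorem hasMaxLawPos_even (k : ℕ) : HasMaxLawPos (2 * k + 2) (posEven k) :=
  (hasMaxLawNeg_odd k).posEven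

/-! ### Uniform points on a grid: multinomial volumes. -/

/-- The number of maps with fibres of prescribed sizes is a multinomial coefficient. -/
theorem card_filter_card_fiber_eq {k n : ℕ} (a : Fin n → ℕ) (ha : ∑ j, a j = k) :
    (Finset.univ.filter fun f : Fin k → Fin n =>
      ∀ j, (Finset.univ.filter fun i => f i = j).card = a j).card =
      Nat.multinomial Finset.univ a := by
  classical
  -- The power `(∑ X_j) ^ k` is expanded once over all maps and once by the multinomial theorem; the
  -- coefficients of the monomial with exponent `a` are compared.
  have key := congrArg (MvPolynomial.coeff (Finsupp.equivFunOnFinite.symm a))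
    ((Fintype.sum_pow (fun j : Fin n => (MvPolynomial.X j : MvPolynomial (Fin n) ℕ)) k).symm.trans
      (Finset.sum_pow_eq_sum_piAntidiag Finset.univ _ k))
  rw [MvPolynomial.coeff_sum, MvPolynomial.coeff_sum] at key
  have h1 : ∀ f : Fin k → Fin n, MvPolynomial.coeff (Finsupp.equivFunOnFinite.symm a)
      (∏ i, (MvPolynomial.X (f i) : MvPolynomial (Fin n) ℕ)) =
      if ∀ j, (Finset.univ.filter fun i => f i = j).card = a j then 1 else 0 := by
    intro f
    have : ∏ i, (MvPolynomial.X (f i) : MvPolynomial (Fin n) ℕ) =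
        MvPolynomial.monomial (∑ i, Finsupp.single (f i) 1) 1 := by
      rw [MvPolynomial.monomial_sum_one]
      rfl
    rw [this, MvPolynomial.coeff_monomial]
    refine if_congr ?_ rfl rfl
    rw [Finsupp.ext_iff]
    refine forall_congr' fun j => ?_
    simp [Finsupp.single_apply]
  have h2 : ∀ b : Fin n → ℕ, MvPolynomial.coeff (Finsupp.equivFunOnFinite.symm a)
      ((Nat.multinomial Finset.univ b : MvPolynomial (Fin n) ℕ) *
        ∏ j, (MvPolynomial.X j : MvPolynomial (Fin n) ℕ) ^ b j) =
      if b = a then Nat.multinomial Finset.univ b else 0 := by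
    intro b
    have : ∏ j, (MvPolynomial.X j : MvPolynomial (Fin n) ℕ) ^ b j =
        MvPolynomial.monomial (Finsupp.equivFunOnFinite.symm b) 1 := by
      rw [MvPolynomial.monomial_eq, MvPolynomial.C_1, one_mul, Finsupp.prod_fintype _ _ (by simp)]
      rfl
    rw [this, ← map_natCast (MvPolynomial.C (σ := Fin n) (R := ℕ)), MvPolynomial.coeff_C_mul,
      MvPolynomial.coeff_monomial]
    simp
  simp_rw [h1, h2] at key
  rw [Finset.card_filter, key, Finset.sum_ite_eq', if_pos]
  simpa using ha

/-- The increments of `ν` over the cells of the grid. -/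
noncomputable def gridIncr (t : ℝ) (n : ℕ) (ν : ℝ → ℕ) (i : Fin n) : ℕ :=
  ν (t * (((i : ℕ) + 1 : ℕ) / n)) - ν (t * ((i : ℕ) / n))

/-- The path on the grid with increments `a`. -/
def gridSum (n : ℕ) (a : Fin n → ℕ) (j : Fin (n + 1)) : ℕ :=
  ∑ i : Fin n, if (i : ℕ) < j then a i else 0

/-- By telescoping, the grid path is a function of its increments; it is the increments whose law is
accessible. -/
theorem gridSum_gridIncr {t : ℝ} (ht : 0 < t) (n : ℕ) {ν : ℝ → ℕ} (hν : Monotone ν)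
    (h0 : ν 0 = 0) : gridSum n (gridIncr t n ν) = gridValues t n ν := by
  ext j
  set f : ℕ → ℕ := fun i => ν (t * (i / n)) with hf
  have hm : Monotone f := by
    intro a b hab
    apply hν
    have : (a : ℝ) ≤ b := by exact_mod_cast hab
    gcongr
  have h1 : gridSum n (gridIncr t n ν) j =
      ∑ i ∈ Finset.range n, if i < j then f (i + 1) - f i else 0 :=
    Fin.sum_univ_eq_sum_range (fun i => if i < j then f (i + 1) - f i else 0) n
  have h2 : (Finset.range n).filter (fun i => i < (j : ℕ)) = Finset.range j := by
    ext i
    simp only [Finset.mem_filter, Finset.mem_range]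
    have := j.2
    omega
  rw [h1, ← Finset.sum_filter, h2, Finset.sum_range_tsub hm]
  simp [hf, h0, gridValues]

theorem sum_gridIncr {t : ℝ} (ht : 0 < t) {n : ℕ} (hn : n ≠ 0) {ν : ℝ → ℕ} (hν : Monotone ν)
    (h0 : ν 0 = 0) : ∑ i, gridIncr t n ν i = ν t := by
  have h := congrFun (gridSum_gridIncr ht n hν h0) (Fin.last n)
  have hn' : (n : ℝ) ≠ 0 := by exact_mod_cast hn
  simpa [gridSum, gridValues, hn'] using h

/-- The cells of the grid. -/
def gridCell (t : ℝ) (n : ℕ) (i : Fin n) : Set ℝ :=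
  Set.Ioc (t * ((i : ℕ) / n)) (t * (((i : ℕ) + 1 : ℕ) / n))

theorem exists_mem_gridCell {t : ℝ} (ht : 0 < t) {n : ℕ} (hn : n ≠ 0) {x : ℝ}
    (hx : x ∈ Set.Ioc 0 t) : ∃ i, x ∈ gridCell t n i := by
  have hn' : (0 : ℝ) < n := by exact_mod_cast Nat.pos_of_ne_zero hn
  have hpos : 0 < x / t * n := by have := hx.1; positivity
  have h1 : 0 < ⌈x / t * n⌉₊ := Nat.ceil_pos.2 hpos
  have h2 : ⌈x / t * n⌉₊ ≤ n := by
    refine Nat.ceil_le.2 ?_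
    have : x / t ≤ 1 := (div_le_one ht).2 hx.2
    exact mul_le_of_le_one_left hn'.le this
  -- The cells are open on the left and closed on the right, so the index is the ceiling minus one
  -- and not the floor.
  obtain ⟨m, hm⟩ : ∃ m, ⌈x / t * n⌉₊ = m + 1 := ⟨_, (Nat.succ_pred_eq_of_pos h1).symm⟩
  have hx' : x = t * (x / t * n / n) := by field_simp
  refine ⟨⟨m, by omega⟩, ?_, ?_⟩
  · have : (m : ℝ) < x / t * n := Nat.lt_ceil.1 (by omega)
    refine lt_of_lt_of_eq ?_ hx'.symm
    change t * ((m : ℝ) / n) < _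
    gcongr
  · have : x / t * n ≤ (m + 1 : ℕ) := Nat.ceil_le.1 hm.le
    refine le_of_eq_of_le hx' ?_
    change _ ≤ t * (((m + 1 : ℕ) : ℝ) / n)
    gcongr

theorem gridCell_subset {t : ℝ} (ht : 0 < t) {n : ℕ} (i : Fin n) :
    gridCell t n i ⊆ Set.Ioc 0 t := by
  intro x hx
  have hn' : (0 : ℝ) < n := by exact_mod_cast i.pos
  refine ⟨lt_of_le_of_lt (by positivity) hx.1, hx.2.trans ?_⟩
  have : (((i : ℕ) + 1 : ℕ) : ℝ) / n ≤ 1 := (div_le_one hn').2 (by exact_mod_cast i.2)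
  exact mul_le_of_le_one_right ht.le this

theorem eq_of_mem_gridCell {t : ℝ} (ht : 0 < t) {n : ℕ} {i j : Fin n} {x : ℝ}
    (hi : x ∈ gridCell t n i) (hj : x ∈ gridCell t n j) : i = j := by
  have key : ∀ {i j : Fin n}, x ∈ gridCell t n i → x ∈ gridCell t n j → ¬ i < j := by
    intro i j hi hj hij
    have h1 : (((i : ℕ) + 1 : ℕ) : ℝ) ≤ (j : ℕ) := by exact_mod_cast hij
    have h2 : t * (((i : ℕ) + 1 : ℕ) / n) ≤ t * ((j : ℕ) / n) := by gcongr
    exact absurd (hi.2.trans h2) hj.1.not_ge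
  exact le_antisymm (not_lt.1 (key hj hi)) (not_lt.1 (key hi hj))

theorem volume_gridCell {t : ℝ} {n : ℕ} (i : Fin n) :
    volume (gridCell t n i) = ENNReal.ofReal (t / n) := by
  rw [gridCell, Real.volume_Ioc]
  congr 1
  push_cast
  ring

open Classical in
theorem gridIncr_pointCount {t : ℝ} (ht : 0 < t) {n k : ℕ} (u : Fin k → ℝ) (j : Fin n) :
    gridIncr t n (pointCount u) j = (Finset.univ.filter fun i => u i ∈ gridCell t n j).card := by
  have hle : t * ((j : ℕ) / n) ≤ t * (((j : ℕ) + 1 : ℕ) / n) := by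
    gcongr
    exact Nat.le_succ _
  rw [gridIncr, Nat.sub_eq_iff_eq_add (monotone_pointCount u hle), Finset.card_filter]
  unfold pointCount
  rw [← Finset.sum_add_distrib]
  refine Finset.sum_congr rfl fun i _ => ?_
  simp only [gridCell, Set.mem_Ioc]
  by_cases h1 : u i ≤ t * ((j : ℕ) / n)
  · rw [if_pos h1, if_pos (h1.trans hle), if_neg fun h => h.1.not_ge h1]
  · simp [h1, not_le.1 h1]

open Classical in
-- The configurations with cell counts `a` form a disjoint union of boxes, one for each assignment
-- of points to cells with fibre sizes `a`; each box has volume `(t / n) ^ k`.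
theorem volume_gridIncr_eq {t : ℝ} (ht : 0 < t) {n k : ℕ} (hn : n ≠ 0) (a : Fin n → ℕ)
    (ha : ∑ j, a j = k) :
    volume ({u : Fin k → ℝ | gridIncr t n (pointCount u) = a} ∩
      Set.univ.pi fun _ => Set.Ioc 0 t) =
      (Nat.multinomial Finset.univ a : ℝ≥0∞) * ENNReal.ofReal (t / n) ^ k := by
  set Fa := Finset.univ.filter fun f : Fin k → Fin n =>
    ∀ j, (Finset.univ.filter fun i => f i = j).card = a j with hFa
  have hset : {u : Fin k → ℝ | gridIncr t n (pointCount u) = a} ∩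
      (Set.univ.pi fun _ => Set.Ioc 0 t) =
      ⋃ f ∈ Fa, Set.univ.pi fun i => gridCell t n (f i) := by
    have hbox : ∀ (f : Fin k → Fin n) (u : Fin k → ℝ), (∀ i, u i ∈ gridCell t n (f i)) →
        ∀ j, gridIncr t n (pointCount u) j = (Finset.univ.filter fun i => f i = j).card := by
      intro f u hu j
      rw [gridIncr_pointCount ht]
      refine congrArg _ (Finset.filter_congr fun i _ => ?_)
      exact ⟨fun h => eq_of_mem_gridCell ht (hu i) h, fun h => h ▸ hu i⟩
    ext u
    simp only [Set.mem_inter_iff, Set.mem_ofPred_eq, Set.mem_pi, Set.mem_univ, true_imp_iff,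
      Set.mem_iUnion, exists_prop, hFa, Finset.mem_filter, Finset.mem_univ, true_and]
    constructor
    · rintro ⟨h1, h2⟩
      choose f hf using fun i => exists_mem_gridCell ht hn (h2 i)
      exact ⟨f, fun j => by rw [← hbox f u hf, h1], hf⟩
    · rintro ⟨f, hf, hu⟩
      exact ⟨funext fun j => by rw [hbox f u hu, hf], fun i => gridCell_subset ht _ (hu i)⟩
  rw [hset, measure_biUnion_finset]
  · simp_rw [volume_pi_pi, volume_gridCell]
    simp only [Finset.prod_const, Finset.card_univ, Fintype.card_fin, Finset.sum_const,
      nsmul_eq_mul]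
    rw [hFa, card_filter_card_fiber_eq a ha]
  · intro f _ g _ hfg
    refine Set.disjoint_left.2 fun u hu hu' => hfg (funext fun i => ?_)
    exact eq_of_mem_gridCell ht (hu i (Set.mem_univ i)) (hu' i (Set.mem_univ i))
  · exact fun f _ => MeasurableSet.univ_pi fun _ => measurableSet_Ioc

/-! ### From the Poisson process to uniform reversal times. -/

section ReversalLaw

variable {Ω : Type*} [MeasurableSpace Ω] {P : Measure Ω} {c : ℝ} {lam : ℝ≥0} {V : Ω → ℝ}
  {N : ℝ≥0 → Ω → ℕ}

/-- The path of `N`, extended to the real line. -/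
def realPath (N : ℝ≥0 → Ω → ℕ) (ω : Ω) (s : ℝ) : ℕ := N s.toNNReal ω

theorem IsPoissonProcess.ae_realPath (h : IsPoissonProcess N lam P) :
    ∀ᵐ ω ∂P, Monotone (realPath N ω) ∧ realPath N ω 0 = 0 := by
  filter_upwards [h.start, h.paths] with ω h0 h1
  exact ⟨fun a b hab => h1.1 (Real.toNNReal_le_toNNReal hab), by simpa [realPath] using h0⟩

theorem IsPoissonProcess.measurable_gridIncr (h : IsPoissonProcess N lam P) (t : ℝ) (n : ℕ) :
    Measurable fun ω => gridIncr t n (realPath N ω) :=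
  measurable_pi_lambda _ fun _ => (h.measurable _).sub (h.measurable _)

theorem IsPoissonProcess.measure_gridIncr_apply (h : IsPoissonProcess N lam P) {t : ℝ}
    (ht : 0 < t) {n : ℕ} (i : Fin n) (m : ℕ) :
    P ((fun ω => gridIncr t n (realPath N ω) i) ⁻¹' {m}) =
      ENNReal.ofReal (Real.exp (-(lam * (t / n))) * (lam * (t / n)) ^ m / m !) := by
  have hle : (t * ((i : ℕ) / n)).toNNReal ≤ (t * (((i : ℕ) + 1 : ℕ) / n)).toNNReal := by
    refine Real.toNNReal_le_toNNReal ?_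
    gcongr
    exact Nat.le_succ _
  have hlaw := h.law _ _ hle
  have hr : ((lam * ((t * (((i : ℕ) + 1 : ℕ) / n)).toNNReal - (t * ((i : ℕ) / n)).toNNReal) :
      ℝ≥0) : ℝ) = lam * (t / n) := by
    rw [NNReal.coe_mul, NNReal.coe_sub hle, Real.coe_toNNReal _ (by positivity),
      Real.coe_toNNReal _ (by positivity)]
    push_cast
    ring
  change P ((fun ω => N (t * (((i : ℕ) + 1 : ℕ) / n)).toNNReal ω -
    N (t * ((i : ℕ) / n)).toNNReal ω) ⁻¹' {m}) = _
  rw [← Measure.map_apply_of_aemeasurable hlaw.aemeasurable (measurableSet_singleton m),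
    hlaw.map_eq, poissonMeasure_singleton, hr]

theorem IsPoissonProcess.measure_gridIncr (h : IsPoissonProcess N lam P) {t : ℝ}
    (ht : 0 < t) (n : ℕ) (a : Fin n → ℕ) :
    P {ω | gridIncr t n (realPath N ω) = a} =
      ∏ i, ENNReal.ofReal (Real.exp (-(lam * (t / n))) * (lam * (t / n)) ^ a i / (a i)!) := by
  have hmono : Monotone fun j : Fin (n + 1) => (t * ((j : ℕ) / n)).toNNReal := by
    intro i j hij
    refine Real.toNNReal_le_toNNReal ?_
    have : ((i : ℕ) : ℝ) ≤ (j : ℕ) := by exact_mod_cast hij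
    gcongr
  have hind := (h.indep n _ hmono).measure_inter_preimage_eq_mul Finset.univ (sets := fun i => {a i})
    fun i _ => measurableSet_singleton _
  rw [Finset.prod_congr rfl fun i _ => (h.measure_gridIncr_apply ht i (a i)).symm]
  convert! hind using 2
  ext ω
  simp only [Set.mem_ofPred_eq, Set.mem_iInter, Finset.mem_univ, true_imp_iff, Set.mem_preimage,
    Set.mem_singleton_iff, funext_iff]
  exact Iff.rfl

theorem IsTelegraphData.measure_inter (h : IsTelegraphData V N c lam P) {t : ℝ}
    (ht : 0 < t) (n : ℕ) (a : Fin n → ℕ) (v : ℝ) :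
    P ({ω | V ω = v} ∩ {ω | gridIncr t n (realPath N ω) = a}) = P {ω | V ω = v} *
      ∏ i, ENNReal.ofReal (Real.exp (-(lam * (t / n))) * (lam * (t / n)) ^ a i / (a i)!) := by
  rw [← h.poisson.measure_gridIncr ht]
  have hm : MeasurableSet {x : ℝ≥0 → ℕ | gridIncr t n (fun s => x s.toNNReal) = a} := by
    have : Measurable fun x : ℝ≥0 → ℕ => gridIncr t n (fun s => x s.toNNReal) :=
      measurable_pi_lambda _ fun _ => (measurable_pi_apply _).sub (measurable_pi_apply _)
    exact this (measurableSet_singleton a)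
  exact h.indep.measure_inter_preimage_eq_mul {v} _ (measurableSet_singleton v) hm

/-- The law of the increments on the grid, restricted to the event that the initial velocity is `v`
and that there are `k` reversals, is that of `k` uniformly distributed points. -/
theorem IsTelegraphData.map_gridIncr (h : IsTelegraphData V N c lam P) {t : ℝ≥0}
    (ht : 0 < t) {n : ℕ} (hn : n ≠ 0) (k : ℕ) (v : ℝ) :
    (P.restrict {ω | V ω = v ∧ N t ω = k}).map (fun ω => gridIncr t n (realPath N ω)) =
      (P {ω | V ω = v} * ENNReal.ofReal (Real.exp (-(lam * t)) * lam ^ k / k !)) •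
        (volume.restrict (Set.univ.pi fun _ : Fin k => Set.Ioc 0 (t : ℝ))).map
          (fun u => gridIncr t n (pointCount u)) := by
  have ht' : (0 : ℝ) < t := ht
  have hn' : (n : ℝ) ≠ 0 := by exact_mod_cast hn
  have hm := h.poisson.measurable_gridIncr t n
  have hmu : Measurable fun u : Fin k → ℝ => gridIncr (t : ℝ) n (pointCount u) :=
    measurable_pi_lambda _ fun _ => (measurable_pointCount _).sub (measurable_pointCount _)
  refine Measure.ext_of_singleton fun a => ?_
  rw [Measure.map_apply hm (measurableSet_singleton a), Measure.smul_apply,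
    Measure.map_apply hmu (measurableSet_singleton a),
    Measure.restrict_apply (hm (measurableSet_singleton a)),
    Measure.restrict_apply (hmu (measurableSet_singleton a)), smul_eq_mul]
  -- Increments with another sum have measure zero on both sides: almost surely they add up to `N t
  -- = k`, and in the cube they add up to the number of points.
  by_cases ha : ∑ j, a j = k
  · have h1 : ((fun ω => gridIncr (t : ℝ) n (realPath N ω)) ⁻¹' {a} ∩
        {ω | V ω = v ∧ N t ω = k} : Set Ω) =ᵐ[P]
        ({ω | V ω = v} ∩ {ω | gridIncr (t : ℝ) n (realPath N ω) = a} : Set Ω) := by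
      rw [Filter.eventuallyEq_set]
      filter_upwards [h.poisson.ae_realPath] with ω hω
      have hs := sum_gridIncr ht' hn hω.1 hω.2
      simp only [Set.mem_inter_iff, Set.mem_preimage, Set.mem_singleton_iff, Set.mem_ofPred_eq]
      constructor
      · exact fun hx => ⟨hx.2.1, hx.1⟩
      · rintro ⟨hx, hy⟩
        refine ⟨hy, hx, ?_⟩
        rw [hy, ha] at hs
        simpa [realPath] using hs.symm
    have h2 := volume_gridIncr_eq ht' hn a ha
    have h3 : ((fun u : Fin k → ℝ => gridIncr (t : ℝ) n (pointCount u)) ⁻¹' {a}) =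
        {u | gridIncr (t : ℝ) n (pointCount u) = a} := rfl
    rw [measure_congr h1, h.measure_inter ht', h3, h2, mul_assoc,
      ← ENNReal.ofReal_prod_of_nonneg (fun i _ => by positivity)]
    congr 1
    rw [← ENNReal.ofReal_natCast, ← ENNReal.ofReal_pow (by positivity),
      ← ENNReal.ofReal_mul (by positivity), ← ENNReal.ofReal_mul (by positivity)]
    congr 1
    -- This identity turns the product of Poisson weights into a multinomial volume divided by `k
    -- !`; the exponentials multiply to `exp (-(lam * t))`.
    have hmul : ((∏ i, (a i)! : ℕ) : ℝ) * (Nat.multinomial Finset.univ a : ℝ) = k ! := by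
      rw [← ha]
      exact_mod_cast Nat.multinomial_spec Finset.univ a
    have hexp : Real.exp (-(lam * (t / n) : ℝ)) ^ n = Real.exp (-(lam * t)) := by
      rw [← Real.exp_nat_mul]
      congr 1
      field_simp
    rw [Finset.prod_div_distrib, Finset.prod_mul_distrib, Finset.prod_const,
      Finset.prod_pow_eq_pow_sum, ha, Finset.card_univ, Fintype.card_fin, hexp, ← hmul, mul_pow]
    have hp : ((∏ i, (a i)! : ℕ) : ℝ) ≠ 0 := by
      exact_mod_cast (Finset.prod_pos fun i _ => Nat.factorial_pos _).ne'
    have hM : (Nat.multinomial Finset.univ a : ℝ) ≠ 0 := by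
      exact_mod_cast (Nat.multinomial_pos Finset.univ a).ne'
    push_cast at hp ⊢
    field_simp
  · have h1 : P ((fun ω => gridIncr (t : ℝ) n (realPath N ω)) ⁻¹' {a} ∩
        {ω | V ω = v ∧ N t ω = k}) = 0 := by
      rw [measure_eq_zero_iff_ae_notMem]
      filter_upwards [h.poisson.ae_realPath] with ω hω
      rintro ⟨hx, -, hy⟩
      have hs := sum_gridIncr ht' hn hω.1 hω.2
      rw [Set.mem_preimage, Set.mem_singleton_iff] at hx
      rw [hx] at hs
      exact ha (hs.trans (by simpa [realPath] using hy))
    have h2 : ((fun u : Fin k → ℝ => gridIncr (t : ℝ) n (pointCount u)) ⁻¹' {a}) ∩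
        (Set.univ.pi fun _ => Set.Ioc 0 (t : ℝ)) = ∅ := by
      rw [Set.eq_empty_iff_forall_notMem]
      rintro u ⟨hu, hu'⟩
      simp only [Set.mem_preimage, Set.mem_singleton_iff] at hu
      apply ha
      rw [← hu, sum_gridIncr ht' hn (monotone_pointCount u)
        (pointCount_eq_zero fun i => (hu' i (Set.mem_univ i)).1)]
      simp only [pointCount, (hu' _ (Set.mem_univ _)).2, if_true]
      simp
    rw [h1, h2, measure_empty, mul_zero]

theorem aemeasurable_runMax {α : Type*} [MeasurableSpace α] {μ : Measure α} {p : α → ℝ → ℕ} {t : ℝ}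
    (ht : 0 < t) (hp : ∀ᵐ x ∂μ, Monotone (p x) ∧ p x 0 = 0)
    (hm : ∀ n, Measurable fun x => gridIncr t n (p x)) (v : ℝ) :
    AEMeasurable (fun x => runMax (velocity v (p x)) t) μ := by
  refine aemeasurable_of_tendsto_metrizable_ae atTop
    (f := fun n x => gridMax v t n (gridSum n (gridIncr t n (p x)))) (fun n => ?_) ?_
  · exact (Measurable.comp (g := fun a => gridMax v t n (gridSum n a))
      (measurable_of_countable _) (hm n)).aemeasurable
  · filter_upwards [hp] with x hx
    simp_rw [gridSum_gridIncr ht _ hx.1 hx.2]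
    exact tendsto_gridMax v ht hx.1

/-- Stated for a general random counting path so that it applies both to `N` and to the points of a
configuration. -/
theorem tendsto_lintegral_map_gridIncr {α : Type*} [MeasurableSpace α] {μ : Measure α}
    [IsFiniteMeasure μ] {p : α → ℝ → ℕ} {t : ℝ}
    (ht : 0 < t) (hp : ∀ᵐ x ∂μ, Monotone (p x) ∧ p x 0 = 0)
    (hm : ∀ n, Measurable fun x => gridIncr t n (p x)) (v : ℝ)
    (f : BoundedContinuousFunction ℝ ℝ≥0) :
    Tendsto (fun n => ∫⁻ a, f (gridMax v t n (gridSum n a)) ∂(μ.map fun x => gridIncr t n (p x)))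
      atTop (𝓝 (∫⁻ x, f (runMax (velocity v (p x)) t) ∂μ)) := by
  have h1 : ∀ n, ∫⁻ a, f (gridMax v t n (gridSum n a)) ∂(μ.map fun x => gridIncr t n (p x)) =
      ∫⁻ x, f (gridMax v t n (gridSum n (gridIncr t n (p x)))) ∂μ := fun n =>
    lintegral_map (f := fun a => (f (gridMax v t n (gridSum n a)) : ℝ≥0∞))
      (measurable_of_countable _) (hm n)
  simp_rw [h1]
  refine tendsto_lintegral_of_dominated_convergence (fun _ => (nndist f 0 : ℝ≥0∞)) (fun n => ?_)
    (fun n => Eventually.of_forall fun x => ?_) ?_ ?_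
  · exact Measurable.comp (g := fun a => (f (gridMax v t n (gridSum n a)) : ℝ≥0∞))
      (measurable_of_countable _) (hm n)
  · exact ENNReal.coe_le_coe.2 (BoundedContinuousFunction.NNReal.upper_bound f _)
  · rw [lintegral_const]
    exact ENNReal.mul_ne_top ENNReal.coe_ne_top (measure_ne_top _ _)
  · filter_upwards [hp] with x hx
    simp_rw [gridSum_gridIncr ht _ hx.1 hx.2]
    exact (ENNReal.continuous_coe.comp f.continuous).continuousAt.tendsto.comp
      (tendsto_gridMax v ht hx.1)

theorem measurable_gridIncr_pointCount (t : ℝ) (n k : ℕ) :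
    Measurable fun u : Fin k → ℝ => gridIncr t n (pointCount u) :=
  measurable_pi_lambda _ fun _ => (measurable_pointCount _).sub (measurable_pointCount _)

theorem ae_pointCount (t : ℝ) (k : ℕ) :
    ∀ᵐ u ∂(volume.restrict (Set.univ.pi fun _ : Fin k => Set.Ioc 0 t)),
      Monotone (pointCount u) ∧ pointCount u 0 = 0 := by
  filter_upwards [ae_restrict_mem (MeasurableSet.univ_pi fun _ => measurableSet_Ioc)] with u hu
  exact ⟨monotone_pointCount u, pointCount_eq_zero fun i => (hu i (Set.mem_univ i)).1⟩

/-- The law of the running maximum, restricted to the event that the initial velocity is `v` and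
that there are `k` reversals. -/
theorem IsTelegraphData.map_runMax [IsProbabilityMeasure P] (h : IsTelegraphData V N c lam P)
    {t : ℝ≥0} (ht : 0 < t) (k : ℕ) (v σ : ℝ) :
    (P.restrict {ω | V ω = v ∧ N t ω = k}).map (fun ω => runMax (velocity σ (realPath N ω)) t) =
      (P {ω | V ω = v} * ENNReal.ofReal (Real.exp (-(lam * t)) * lam ^ k / k !)) •
        (volume.restrict (Set.univ.pi fun _ : Fin k => Set.Ioc 0 (t : ℝ))).map
          (fun u => runMax (velocity σ (pointCount u)) t) := by
  have ht' : (0 : ℝ) < t := ht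
  have : IsFiniteMeasure
      (volume.restrict (Set.univ.pi fun _ : Fin k => Set.Ioc 0 (t : ℝ))) := by
    refine ⟨?_⟩
    rw [Measure.restrict_apply_univ, volume_pi_pi]
    simp
  have hp := ae_restrict_of_ae (s := {ω | V ω = v ∧ N t ω = k}) h.poisson.ae_realPath
  have hm := fun n => h.poisson.measurable_gridIncr (t : ℝ) n
  have hmu := fun n => measurable_gridIncr_pointCount (t : ℝ) n k
  -- Finite measures are determined by bounded continuous test functions. For these both sides are
  -- limits of grid integrals, which coincide for each `n ≠ 0` by `map_gridIncr`.
  refine ext_of_forall_lintegral_eq_of_IsFiniteMeasure fun f => ?_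
  have hf : Measurable fun x => (f x : ℝ≥0∞) :=
    (ENNReal.continuous_coe.comp f.continuous).measurable
  rw [lintegral_map' hf.aemeasurable (aemeasurable_runMax ht' hp hm σ), lintegral_smul_measure,
    lintegral_map hf (measurable_runMax_pointCount σ ht' k)]
  have hK : P {ω | V ω = v} * ENNReal.ofReal (Real.exp (-(lam * t)) * lam ^ k / k !) ≠ ∞ :=
    ENNReal.mul_ne_top (measure_ne_top _ _) ENNReal.ofReal_ne_top
  have h1 := tendsto_lintegral_map_gridIncr ht' hp hm σ f
  have h2 := ENNReal.Tendsto.const_mul (tendsto_lintegral_map_gridIncr ht' (ae_pointCount t k)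
    hmu σ f) (Or.inr hK)
  refine tendsto_nhds_unique_of_eventuallyEq h1 h2 ?_
  filter_upwards [eventually_ne_atTop 0] with n hn
  rw [h.map_gridIncr ht hn k v, lintegral_smul_measure]
  rfl

theorem IsTelegraphData.setLIntegral_runMax [IsProbabilityMeasure P]
    (h : IsTelegraphData V N c lam P) {t : ℝ≥0} (ht : 0 < t) (k : ℕ) (v σ : ℝ) {g : ℝ → ℝ≥0∞}
    (hg : Measurable g) :
    ∫⁻ ω in {ω | V ω = v ∧ N t ω = k}, g (runMax (velocity σ (realPath N ω)) t) ∂P =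
      P {ω | V ω = v} * ENNReal.ofReal (Real.exp (-(lam * t)) * lam ^ k / k !) *
        maxIntegral σ k t g := by
  have ht' : (0 : ℝ) < t := ht
  have hp := ae_restrict_of_ae (s := {ω | V ω = v ∧ N t ω = k}) h.poisson.ae_realPath
  rw [← lintegral_map' hg.aemeasurable
    (aemeasurable_runMax ht' hp (fun n => h.poisson.measurable_gridIncr (t : ℝ) n) σ),
    h.map_runMax ht, lintegral_smul_measure, lintegral_map hg (measurable_runMax_pointCount σ ht' k)]
  rfl

end ReversalLaw

/-! ### Conditional moments as integrals over reversal times. -/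

section Conditional

variable {Ω : Type*} [MeasurableSpace Ω] {P : Measure Ω} {c : ℝ} {lam : ℝ≥0} {V : Ω → ℝ}
  {N : ℝ≥0 → Ω → ℕ}

theorem IsTelegraphData.measurableSet_inter (h : IsTelegraphData V N c lam P) (t : ℝ≥0) (k : ℕ)
    (v : ℝ) : MeasurableSet {ω | V ω = v ∧ N t ω = k} :=
  (h.measurable_velocity (measurableSet_singleton v)).inter
    (h.poisson.measurable t (measurableSet_singleton k))

theorem IsTelegraphData.telegraphMax_ae_eq (h : IsTelegraphData V N c lam P) (hc : 0 ≤ c) (t : ℝ≥0)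
    (σ : ℝ) : ∀ᵐ ω ∂P, V ω = σ * c →
      telegraphMax V N t ω = c * runMax (velocity σ (realPath N ω)) t := by
  filter_upwards [h.poisson.ae_realPath] with ω hω hV
  rw [telegraphMax_eq_runMax, hV,
    ← runMax_const_mul (intervalIntegrable_velocity _ hω.1) t.coe_nonneg hc]
  congr 1
  ext r
  simp only [velocity, realPath]
  ring

theorem IsTelegraphData.ae_velocity [IsProbabilityMeasure P] (h : IsTelegraphData V N c lam P)
    (hc : 0 < c) : ∀ᵐ ω ∂P, V ω = c ∨ V ω = -c := by
  have hm : ∀ v, MeasurableSet {ω | V ω = v} := fun v =>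
    h.measurable_velocity (measurableSet_singleton v)
  have hd : Disjoint {ω | V ω = c} {ω | V ω = -c} := by
    rw [Set.disjoint_left]
    intro ω h1 h2
    rw [Set.mem_ofPred_eq] at h1 h2
    linarith
  have hu : P ({ω | V ω = c} ∪ {ω | V ω = -c}) = 1 := by
    rw [measure_union hd (hm _), h.prob_pos, h.prob_neg, ENNReal.add_halves]
  exact (mem_ae_iff_prob_eq_one ((hm _).union (hm _))).2 hu

theorem IsTelegraphData.ae_telegraphMax_mem [IsProbabilityMeasure P]
    (h : IsTelegraphData V N c lam P) (hc : 0 < c) (t : ℝ≥0) :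
    ∀ᵐ ω ∂P, 0 ≤ telegraphMax V N t ω ∧ telegraphMax V N t ω ≤ c * t := by
  filter_upwards [h.poisson.ae_realPath, h.ae_velocity hc, h.telegraphMax_ae_eq hc.le t 1,
    h.telegraphMax_ae_eq hc.le t (-1)] with ω h1 h2 h3 h4
  have key : ∀ σ : ℝ, |σ| = 1 → 0 ≤ c * runMax (velocity σ (realPath N ω)) t ∧
      c * runMax (velocity σ (realPath N ω)) t ≤ c * t := fun σ hσ =>
    ⟨mul_nonneg hc.le (runMax_nonneg (intervalIntegrable_velocity _ h1.1) t.2),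
      mul_le_mul_of_nonneg_left (runMax_le (intervalIntegrable_velocity _ h1.1) t.2
        fun r => by rw [abs_velocity, hσ]) hc.le⟩
  rcases h2 with h2 | h2
  · rw [h3 (by simpa using h2)]
    exact key 1 (by simp)
  · rw [h4 (by simpa using h2)]
    exact key (-1) (by simp)

/-- On each of the two velocity events the maximum is a.e. a multiple of a unit-speed maximum, and
these events cover almost everything. -/
theorem IsTelegraphData.aemeasurable_telegraphMax [IsProbabilityMeasure P]
    (h : IsTelegraphData V N c lam P) (hc : 0 < c) {t : ℝ≥0} (ht : 0 < t) :
    AEMeasurable (telegraphMax V N t) P := by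
  have hm : ∀ v, MeasurableSet {ω | V ω = v} := fun v =>
    h.measurable_velocity (measurableSet_singleton v)
  have key : ∀ σ : ℝ, AEMeasurable (telegraphMax V N t) (P.restrict {ω | V ω = σ * c}) := by
    intro σ
    have h1 := ((aemeasurable_runMax (t := t) ht h.poisson.ae_realPath
      (fun n => h.poisson.measurable_gridIncr (t : ℝ) n) σ).const_mul c).mono_measure
      (Measure.restrict_le_self (s := {ω | V ω = σ * c}))
    refine h1.congr ?_
    filter_upwards [ae_restrict_of_ae (h.telegraphMax_ae_eq hc.le t σ),
      ae_restrict_mem (hm (σ * c))] with ω h2 h3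
    exact (h2 h3).symm
  have hu : P.restrict ({ω | V ω = 1 * c} ∪ {ω | V ω = -1 * c}) = P := by
    refine Measure.restrict_eq_self_of_ae_mem ?_
    filter_upwards [h.ae_velocity hc] with ω hω
    simpa using hω
  rw [← hu, aemeasurable_union_iff]
  exact ⟨key 1, key (-1)⟩

theorem IsTelegraphData.integrable_telegraphMax_pow [IsProbabilityMeasure P]
    (h : IsTelegraphData V N c lam P) (hc : 0 < c) {t : ℝ≥0} (ht : 0 < t) (m : ℕ) :
    Integrable (fun ω => telegraphMax V N t ω ^ m) P := by
  refine Integrable.of_bound ((h.aemeasurable_telegraphMax hc ht).pow_const m).aestronglyMeasurable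
    ((c * t) ^ m) ?_
  filter_upwards [h.ae_telegraphMax_mem hc t] with ω hω
  rw [Real.norm_eq_abs, abs_of_nonneg (pow_nonneg hω.1 m)]
  exact pow_le_pow_left₀ hω.1 hω.2 m

theorem IsTelegraphData.setLIntegral_telegraphMax [IsProbabilityMeasure P]
    (h : IsTelegraphData V N c lam P) (hc : 0 ≤ c) {t : ℝ≥0} (ht : 0 < t) (k : ℕ) (σ : ℝ)
    {g : ℝ → ℝ≥0∞} (hg : Measurable g) :
    ∫⁻ ω in {ω | V ω = σ * c ∧ N t ω = k}, g (telegraphMax V N t ω) ∂P =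
      P {ω | V ω = σ * c} * ENNReal.ofReal (Real.exp (-(lam * t)) * lam ^ k / k !) *
        maxIntegral σ k t fun x => g (c * x) := by
  rw [← h.setLIntegral_runMax ht k _ σ (g := fun x => g (c * x)) (hg.comp (by fun_prop))]
  refine lintegral_congr_ae ?_
  filter_upwards [ae_restrict_of_ae (h.telegraphMax_ae_eq hc t σ),
    ae_restrict_mem (h.measurableSet_inter t k _)] with ω h2 h3
  rw [h2 h3.1]

/-- The case `g = 1` of `setLIntegral_telegraphMax`, where the cube supplies the factor `t ^ k`. -/
theorem IsTelegraphData.measure_inter_eq [IsProbabilityMeasure P]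
    (h : IsTelegraphData V N c lam P) (hc : 0 ≤ c) {t : ℝ≥0} (ht : 0 < t) (k : ℕ) (σ : ℝ) :
    P {ω | V ω = σ * c ∧ N t ω = k} =
      P {ω | V ω = σ * c} * ENNReal.ofReal (Real.exp (-(lam * t)) * (lam * t) ^ k / k !) := by
  have h1 := h.setLIntegral_telegraphMax hc ht k σ (g := fun _ => 1) measurable_const
  rw [maxIntegral_const_one, lintegral_const, one_mul, Measure.restrict_apply_univ] at h1
  rw [h1, mul_assoc, ← ENNReal.ofReal_pow t.coe_nonneg, ← ENNReal.ofReal_mul (by positivity)]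
  congr 2
  ring

/-- Dividing by the probability of the event cancels the Poisson weight and leaves the uniform
average over the cube, which no longer involves `lam`. -/
theorem IsTelegraphData.lintegral_cond [IsProbabilityMeasure P]
    (h : IsTelegraphData V N c lam P) (hc : 0 ≤ c) (hlam : 0 < lam) {t : ℝ≥0} (ht : 0 < t) (k : ℕ)
    {σ : ℝ} (hσ : P {ω | V ω = σ * c} = 1 / 2) {g : ℝ → ℝ≥0∞} (hg : Measurable g) :
    ∫⁻ ω, g (telegraphMax V N t ω) ∂(ProbabilityTheory.cond P {ω | V ω = σ * c ∧ N t ω = k}) =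
      ENNReal.ofReal (1 / t ^ k) * maxIntegral σ k t fun x => g (c * x) := by
  have ht' : (0 : ℝ) < t := ht
  have hl' : (0 : ℝ) < lam := hlam
  rw [ProbabilityTheory.cond, lintegral_smul_measure, h.setLIntegral_telegraphMax hc ht k σ hg,
    h.measure_inter_eq hc ht, smul_eq_mul, ← mul_assoc, hσ]
  congr 1
  have h2 : (1 / 2 : ℝ≥0∞) = ENNReal.ofReal (1 / 2) := by
    rw [ENNReal.ofReal_div_of_pos two_pos]; simp
  rw [h2, ← ENNReal.ofReal_mul (by positivity), ← ENNReal.ofReal_mul (by positivity),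
    ← ENNReal.ofReal_inv_of_pos (by positivity), ← ENNReal.ofReal_mul (by positivity)]
  congr 1
  rw [mul_pow]
  field_simp

theorem IsTelegraphData.condMaxMoment_eq [IsProbabilityMeasure P]
    (h : IsTelegraphData V N c lam P) (hc : 0 < c) (hlam : 0 < lam) {t : ℝ≥0} (ht : 0 < t) (m k : ℕ)
    {σ : ℝ} (hσ : P {ω | V ω = σ * c} = 1 / 2) :
    condMaxMoment P V N t m {ω | V ω = σ * c ∧ N t ω = k} = c ^ m / t ^ k *
      (maxIntegral σ k t fun x => ENNReal.ofReal (x ^ m)).toReal := by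
  have hac := ProbabilityTheory.cond_absolutelyContinuous (μ := P)
    (s := {ω | V ω = σ * c ∧ N t ω = k})
  rw [condMaxMoment, integral_eq_lintegral_of_nonneg_ae,
    h.lintegral_cond hc.le hlam ht k hσ (g := fun x => ENNReal.ofReal (x ^ m)) (by fun_prop),
    ENNReal.toReal_mul, ENNReal.toReal_ofReal (by positivity)]
  · have : (fun x : ℝ => ENNReal.ofReal ((c * x) ^ m)) =
        fun x => ENNReal.ofReal (c ^ m) * ENNReal.ofReal (x ^ m) := by
      ext x
      rw [mul_pow, ENNReal.ofReal_mul (by positivity)]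
    have h2 : maxIntegral σ k t (fun x => ENNReal.ofReal ((c * x) ^ m)) =
        ENNReal.ofReal (c ^ m) * maxIntegral σ k t fun x => ENNReal.ofReal (x ^ m) := by
      rw [this]
      exact lintegral_const_mul' _ _ ENNReal.ofReal_ne_top
    rw [h2, ENNReal.toReal_mul, ENNReal.toReal_ofReal (by positivity)]
    ring
  · filter_upwards [hac.ae_le (h.ae_telegraphMax_mem hc t)] with ω hω
    exact pow_nonneg hω.1 m
  · exact (((h.aemeasurable_telegraphMax hc ht).pow_const m).mono_ac hac).aestronglyMeasurable

/-- The moments of the maximum as a mixture over the number of reversals. -/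
theorem IsTelegraphData.hasSum_condMaxMoment [IsProbabilityMeasure P]
    (h : IsTelegraphData V N c lam P) (hc : 0 < c) (hlam : 0 < lam) {t : ℝ≥0} (ht : 0 < t) (m : ℕ) :
    HasSum (fun k : ℕ => Real.exp (-(lam * t)) * (lam * t) ^ k / k ! *
      condMaxMoment P V N t m {ω | V ω = c ∧ N t ω = k})
      (condMaxMoment P V N t m {ω | V ω = c}) := by
  have ht' : (0 : ℝ) < t := ht
  have hl' : (0 : ℝ) < lam := hlam
  have hU : {ω | V ω = c} = ⋃ k : ℕ, {ω | V ω = c ∧ N t ω = k} := by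
    ext ω; simp
  have hs := hasSum_integral_iUnion (μ := P) (f := fun ω => telegraphMax V N t ω ^ m)
    (fun k => h.measurableSet_inter t k c)
    (fun i j hij => Set.disjoint_left.2 fun ω h1 h2 => hij (h1.2.symm.trans h2.2))
    (h.integrable_telegraphMax_pow hc ht m).integrableOn
  rw [← hU] at hs
  have h2 : ((P {ω | V ω = c})⁻¹).toReal = 2 := by rw [h.prob_pos]; simp
  have h3 : condMaxMoment P V N t m {ω | V ω = c} =
      2 * ∫ ω in {ω | V ω = c}, telegraphMax V N t ω ^ m ∂P := by
    rw [condMaxMoment, ProbabilityTheory.cond, integral_smul_measure, h2, smul_eq_mul]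
  rw [h3]
  refine (hs.mul_left 2).congr_fun ?_
  intro k
  have h4 := h.measure_inter_eq hc.le ht k 1
  rw [one_mul, h.prob_pos] at h4
  rw [condMaxMoment, ProbabilityTheory.cond, integral_smul_measure, h4, smul_eq_mul,
    ENNReal.toReal_inv, ENNReal.toReal_mul, ENNReal.toReal_ofReal (by positivity)]
  simp only [one_div, ENNReal.toReal_inv, ENNReal.toReal_ofNat]
  field_simp

end Conditional

/-! ### Moments of the densities. -/

theorem setLIntegral_ofReal_mul_pow {u : ℝ → ℝ} {t : ℝ} (ht : 0 < t) (hu : Continuous u)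
    (h0 : ∀ x ∈ Set.Ioo 0 t, 0 ≤ u x) (m : ℕ) :
    ∫⁻ x in Set.Ioo 0 t, ENNReal.ofReal (u x) * ENNReal.ofReal (x ^ m) =
      ENNReal.ofReal (∫ x in (0 : ℝ)..t, x ^ m * u x) := by
  rw [← setLIntegral_ofReal_eq_ofReal ht.le (by fun_prop)
    fun s hs => mul_nonneg (pow_nonneg hs.1.le m) (h0 s hs)]
  refine setLIntegral_congr_fun measurableSet_Ioo fun x hx => ?_
  rw [ENNReal.ofReal_mul (pow_nonneg hx.1.le m), mul_comm]

theorem integral_pow_mul_nonneg {u : ℝ → ℝ} {t : ℝ} (ht : 0 < t)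
    (h0 : ∀ x ∈ Set.Ioo 0 t, 0 ≤ u x) (m : ℕ) : 0 ≤ ∫ x in (0 : ℝ)..t, x ^ m * u x := by
  rw [intervalIntegral.integral_of_le ht.le, integral_Ioc_eq_integral_Ioo]
  exact setIntegral_nonneg measurableSet_Ioo
    fun x hx => mul_nonneg (pow_nonneg hx.1.le m) (h0 x hx)

theorem HasMaxLawPos.toReal_maxIntegral {n : ℕ} {w : ℝ → ℝ → ℝ} (h : HasMaxLawPos n w)
    (hw : Continuous (Function.uncurry w)) (h0 : ∀ t, ∀ x ∈ Set.Ioo 0 t, 0 ≤ w t x) {t : ℝ}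
    (ht : 0 < t) (m : ℕ) :
    (maxIntegral 1 n t fun x => ENNReal.ofReal (x ^ m)).toReal =
      n ! * ∫ x in (0 : ℝ)..t, x ^ m * w t x := by
  have hc : Continuous (w t) := hw.comp (f := fun x => (t, x)) (by fun_prop)
  rw [h t ht _ (by fun_prop), setLIntegral_ofReal_mul_pow ht hc (h0 t), ENNReal.toReal_mul,
    ENNReal.toReal_ofReal (integral_pow_mul_nonneg ht (h0 t) m)]
  simp

/-- The atom at `0` does not contribute to moments of positive order; for `m = 0` it would, since `0
^ 0 = 1`. -/
theorem HasMaxLawNeg.toReal_maxIntegral {n : ℕ} {z : ℝ → ℝ} {u : ℝ → ℝ → ℝ}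
    (h : HasMaxLawNeg n z u) (hu : Continuous (Function.uncurry u))
    (h0 : ∀ t, ∀ x ∈ Set.Ioo 0 t, 0 ≤ u t x) {t : ℝ} (ht : 0 < t) {m : ℕ} (hm : m ≠ 0) :
    (maxIntegral (-1) n t fun x => ENNReal.ofReal (x ^ m)).toReal =
      n ! * ∫ x in (0 : ℝ)..t, x ^ m * u t x := by
  have hc : Continuous (u t) := hu.comp (f := fun x => (t, x)) (by fun_prop)
  rw [h t ht _ (by fun_prop), setLIntegral_ofReal_mul_pow ht hc (h0 t), ENNReal.toReal_mul,
    zero_pow hm, ENNReal.ofReal_zero, mul_zero, zero_add,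
    ENNReal.toReal_ofReal (integral_pow_mul_nonneg ht (h0 t) m)]
  simp

/-- The substitution `x ^ 2 = t ^ 2 * y` would give a Beta integral. The induction instead peels off
one factor `t ^ 2 - x ^ 2`, which sends `m` to `m + 2` and thus shifts the Gamma argument by one;
the functional equation of Gamma closes it. -/
theorem integral_pow_mul_sub_mul_add (k m : ℕ) (t : ℝ) :
    ∫ x in (0 : ℝ)..t, x ^ m * ((t - x) ^ k * (t + x) ^ k) = t ^ (m + 2 * k + 1) * k ! / 2 *
      (Real.Gamma (((m : ℝ) + 1) / 2) / Real.Gamma (k + 1 + ((m : ℝ) + 1) / 2)) := by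
  induction k generalizing m with
  | zero =>
    have ha : (0 : ℝ) < ((m : ℝ) + 1) / 2 := by positivity
    have hG := (Real.Gamma_pos_of_pos ha).ne'
    simp only [pow_zero, mul_one, integral_pow, Nat.factorial_zero, Nat.cast_one, Nat.cast_zero,
      zero_add, mul_zero, add_zero, add_comm (1 : ℝ) (((m : ℝ) + 1) / 2)]
    rw [Real.Gamma_add_one ha.ne']
    field_simp
    simp
  | succ k ih =>
    have h1 : ∀ x : ℝ, x ^ m * ((t - x) ^ (k + 1) * (t + x) ^ (k + 1)) =
        t ^ 2 * (x ^ m * ((t - x) ^ k * (t + x) ^ k)) -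
          x ^ (m + 2) * ((t - x) ^ k * (t + x) ^ k) := fun x => by ring
    simp_rw [h1]
    rw [intervalIntegral.integral_sub (Continuous.intervalIntegrable (by fun_prop) _ _)
      (Continuous.intervalIntegrable (by fun_prop) _ _), intervalIntegral.integral_const_mul,
      ih, ih]
    have e1 : (((m + 2 : ℕ) : ℝ) + 1) / 2 = ((m : ℝ) + 1) / 2 + 1 := by push_cast; ring
    rw [e1]
    set a : ℝ := ((m : ℝ) + 1) / 2 with ha'
    have ha : 0 < a := by positivity
    have e2 : (k : ℝ) + 1 + (a + 1) = (k + 1 + a) + 1 := by ring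
    have e3 : ((k + 1 : ℕ) : ℝ) + 1 + a = (k + 1 + a) + 1 := by push_cast; ring
    have hka : 0 < (k : ℝ) + 1 + a := by positivity
    have hG := (Real.Gamma_pos_of_pos hka).ne'
    rw [e2, e3, Real.Gamma_add_one hka.ne', Real.Gamma_add_one ha.ne', Nat.factorial_succ]
    push_cast
    field_simp
    ring

theorem integral_pow_mul_posOdd (k m : ℕ) (t : ℝ) :
    ∫ x in (0 : ℝ)..t, x ^ m * posOdd k t x = lawConst k * (t ^ (m + 2 * k + 1) * k ! / 2 *
      (Real.Gamma (((m : ℝ) + 1) / 2) / Real.Gamma (k + 1 + ((m : ℝ) + 1) / 2))) := by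
  rw [← integral_pow_mul_sub_mul_add, ← intervalIntegral.integral_const_mul]
  refine intervalIntegral.integral_congr fun x _ => ?_
  simp only [posOdd]
  ring

theorem integral_pow_mul_negEven (k m : ℕ) (t : ℝ) :
    ∫ x in (0 : ℝ)..t, x ^ m * negEven k t x = lawConst k * k ! * t ^ (m + 2 * k) *
      (Real.Gamma (((m : ℝ) + 1) / 2) / Real.Gamma (k + ((m : ℝ) + 1) / 2) -
        Real.Gamma ((m : ℝ) / 2 + 1) / Real.Gamma (k + 1 + (m : ℝ) / 2)) := by
  cases k with
  -- For `k = 0` both Gamma quotients equal `1`, matching the vanishing density.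
  | zero =>
    have h1 := (Real.Gamma_pos_of_pos (show 0 < ((m : ℝ) + 1) / 2 by positivity)).ne'
    have h2 := (Real.Gamma_pos_of_pos (show 0 < 1 + (m : ℝ) / 2 by positivity)).ne'
    simp [negEven, h1, h2, add_comm ((m : ℝ) / 2) 1]
  | succ k =>
    have hc : Continuous (posOdd k t) :=
      (continuous_posOdd k).comp (f := fun x => (t, x)) (by fun_prop)
    have h3 : ∀ x, x ^ m * negEven (k + 1) t x = t / (2 * k + 2) * (x ^ m * posOdd k t x) -
        1 / (2 * k + 2) * (x ^ (m + 1) * posOdd k t x) := fun x => by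
      rw [_root_.negEven_succ]; ring
    simp_rw [h3]
    rw [intervalIntegral.integral_sub (Continuous.intervalIntegrable (by fun_prop) _ _)
      (Continuous.intervalIntegrable (by fun_prop) _ _), intervalIntegral.integral_const_mul,
      intervalIntegral.integral_const_mul, integral_pow_mul_posOdd, integral_pow_mul_posOdd,
      lawConst_succ, Nat.factorial_succ]
    have e1 : (((m + 1 : ℕ) : ℝ) + 1) / 2 = (m : ℝ) / 2 + 1 := by push_cast; ring
    have e2 : ((k + 1 : ℕ) : ℝ) + 1 + (m : ℝ) / 2 = k + 1 + ((m : ℝ) / 2 + 1) := by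
      push_cast; ring
    rw [e1, e2]
    push_cast
    generalize Real.Gamma (((m : ℝ) + 1) / 2) / Real.Gamma ((k : ℝ) + 1 + ((m : ℝ) + 1) / 2) = A
    generalize Real.Gamma ((m : ℝ) / 2 + 1) / Real.Gamma ((k : ℝ) + 1 + ((m : ℝ) / 2 + 1)) = B
    have : (k : ℝ) + 1 ≠ 0 := by positivity
    rw [show 2 * (k : ℝ) + 2 = 2 * (k + 1) by ring]
    field_simp
    ring

/-- Comparing two values of the total mass of `posOdd k 1`, the Gamma quotient for `m = 0` and the
volume of the cube, gives the half-integer value with no duplication formula. -/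
theorem Gamma_half_div_Gamma (k : ℕ) :
    Real.Gamma (1 / 2) / Real.Gamma (k + 1 + 1 / 2) = 2 * 4 ^ k * k ! / (2 * k + 1)! := by
  have h1 := integral_pow_mul_posOdd k 0 1
  simp only [pow_zero, one_mul, one_pow, integral_posOdd k one_pos, Nat.cast_zero, zero_add] at h1
  rw [lawConst] at h1
  have hf : (k ! : ℝ) ≠ 0 := by positivity
  have hf' : ((2 * k + 1)! : ℝ) ≠ 0 := by positivity
  generalize Real.Gamma (1 / 2) / Real.Gamma (k + 1 + 1 / 2) = A at h1 ⊢
  field_simp at h1 ⊢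
  linarith

theorem Gamma_three_halves_div_Gamma (k : ℕ) :
    Real.Gamma (1 / 2 + 1) / Real.Gamma (k + 1 + 1 / 2) = 4 ^ k * k ! / (2 * k + 1)! := by
  rw [Real.Gamma_add_one (by norm_num), mul_div_assoc, Gamma_half_div_Gamma]
  ring

/-! ### The mean for an even number of reversals is largest at `k = 2`. -/

/-- The probability that a symmetric random walk returns to `0` after `2 k` steps decays slowly. -/
theorem centralBinom_div_gt {k : ℕ} (hk : 2 ≤ k) :
    4 * ((k : ℝ) + 1) / ((2 * k + 1) * (2 * k + 3)) <
      ((2 * k)! : ℝ) / ((k ! : ℝ) ^ 2 * 2 ^ (2 * k)) := by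
  induction k, hk using Nat.le_induction with
  | base => norm_num [Nat.factorial]
  | succ k hk ih =>
    have h1 : ((2 * (k + 1))! : ℝ) / (((k + 1)! : ℝ) ^ 2 * 2 ^ (2 * (k + 1))) =
        ((2 * k)! : ℝ) / ((k ! : ℝ) ^ 2 * 2 ^ (2 * k)) * ((2 * k + 1) / (2 * k + 2)) := by
      rw [show 2 * (k + 1) = 2 * k + 1 + 1 by ring, Nat.factorial_succ, Nat.factorial_succ (2 * k),
        Nat.factorial_succ k]
      push_cast
      field_simp
      ring
    -- The induction closes because the old bound times the ratio of successive terms is `2 / (2 k +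
    -- 3)`, which exceeds the new bound.
    have h2 : 4 * ((k : ℝ) + 1) / ((2 * k + 1) * (2 * k + 3)) * ((2 * k + 1) / (2 * k + 2)) =
        2 / (2 * k + 3) := by
      field_simp
      ring
    have h3 := mul_lt_mul_of_pos_right ih (show (0 : ℝ) < (2 * k + 1) / (2 * k + 2) by positivity)
    rw [h1]
    refine lt_of_le_of_lt ?_ h3
    rw [h2]
    push_cast
    rw [div_le_div_iff₀ (by positivity) (by positivity)]
    nlinarith

/-- From `k` to `k + 1` the binomial term `p` loses `p / (2 (k + 1))`, while the subtracted fraction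
loses `2 / ((2 k + 1) (2 k + 3))`. The difference decreases exactly when `p > 4 (k + 1) / ((2 k + 1)
(2 k + 3))`, which `centralBinom_div_gt` provides from `k = 2` on; `k = 0` and `k = 1` are compared
numerically. -/
theorem centralBinom_sub_lt {k : ℕ} (hk : k ≠ 2) :
    ((2 * k)! : ℝ) / ((k ! : ℝ) ^ 2 * 2 ^ (2 * k)) - 1 / (2 * k + 1) <
      ((2 * 2)! : ℝ) / ((2 ! : ℝ) ^ 2 * 2 ^ (2 * 2)) - 1 / (2 * (2 : ℕ) + 1) := by
  have key : ∀ k : ℕ, 2 ≤ k →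
      ((2 * (k + 1))! : ℝ) / (((k + 1)! : ℝ) ^ 2 * 2 ^ (2 * (k + 1))) - 1 / (2 * (k + 1 : ℕ) + 1) <
      ((2 * k)! : ℝ) / ((k ! : ℝ) ^ 2 * 2 ^ (2 * k)) - 1 / (2 * k + 1) := by
    intro k hk
    have h1 : ((2 * (k + 1))! : ℝ) / (((k + 1)! : ℝ) ^ 2 * 2 ^ (2 * (k + 1))) =
        ((2 * k)! : ℝ) / ((k ! : ℝ) ^ 2 * 2 ^ (2 * k)) * (1 - 1 / (2 * (k + 1))) := by
      rw [show 2 * (k + 1) = 2 * k + 1 + 1 by ring, Nat.factorial_succ, Nat.factorial_succ (2 * k),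
        Nat.factorial_succ k]
      push_cast
      field_simp
      ring
    have h2 := mul_lt_mul_of_pos_right (centralBinom_div_gt hk)
      (show (0 : ℝ) < 1 / (2 * (k + 1)) by positivity)
    have h3 : 4 * ((k : ℝ) + 1) / ((2 * k + 1) * (2 * k + 3)) * (1 / (2 * (k + 1))) =
        1 / (2 * k + 1) - 1 / (2 * (k + 1 : ℕ) + 1) := by
      push_cast
      field_simp
      ring
    rw [h3] at h2
    rw [h1]
    linarith
  rcases lt_or_gt_of_ne hk with h | h
  · interval_cases k <;> norm_num [Nat.factorial]
  · obtain ⟨j, rfl⟩ : ∃ j, k = j + 3 := ⟨k - 3, by omega⟩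
    clear hk h
    induction j with
    | zero => exact key 2 le_rfl
    | succ j ih => exact (key (j + 3) (by omega)).trans ih

/-! ### Bessel series. -/

/-- Multiplying the series of the modified Bessel function by a power of its argument. -/
theorem rpow_mul_besselI (ν : ℝ) {x : ℝ} (hx : 0 < x) :
    (2 / x) ^ ν * besselI ν x =
      ∑' j : ℕ, (x / 2) ^ (2 * j) / ((j ! : ℝ) * Real.Gamma (j + ν + 1)) := by
  rw [besselI, ← tsum_mul_left]
  refine tsum_congr fun j => ?_
  have hx2 : 0 < x / 2 := by positivity
  have h1 : (2 / x) ^ ν * (x / 2) ^ ν = 1 := by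
    rw [← Real.mul_rpow (by positivity) hx2.le]
    have : 2 / x * (x / 2) = 1 := by field_simp
    rw [this, Real.one_rpow]
  have h2 : (x / 2) ^ (2 * (j : ℝ)) = (x / 2) ^ (2 * j) := by
    rw [← Real.rpow_natCast]; push_cast; rfl
  rw [Real.rpow_add hx2, h2, mul_div_assoc', mul_comm _ ((x / 2) ^ ν), ← mul_assoc, h1, one_mul]

/-- Even terms sum to the function of order `a - 1` and odd terms to that of order `a`; the extra `x
/ 2` in the odd terms absorbs the difference between `(2 / x) ^ a` and `(2 / x) ^ (a - 1)`. -/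
theorem HasSum.eq_besselI {x a K S : ℝ} (hx : 0 < x) {f : ℕ → ℝ} (hs : HasSum f S)
    (heven : ∀ j : ℕ, f (2 * j) =
      K * ((x / 2) ^ (2 * j) / ((j ! : ℝ) * Real.Gamma (j + (a - 1) + 1))))
    (hodd : ∀ j : ℕ, f (2 * j + 1) =
      K * (x / 2) * ((x / 2) ^ (2 * j) / ((j ! : ℝ) * Real.Gamma (j + a + 1)))) :
    S = K * (2 / x) ^ (a - 1) * (besselI (a - 1) x + besselI a x) := by
  have hse : Summable fun j : ℕ => f (2 * j) :=
    hs.summable.comp_injective (i := fun j : ℕ => 2 * j) fun i j hij => by simpa using hij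
  have hso : Summable fun j : ℕ => f (2 * j + 1) :=
    hs.summable.comp_injective (i := fun j : ℕ => 2 * j + 1) fun i j hij => by simpa using hij
  have hpow : (2 / x) ^ a = (2 / x) ^ (a - 1) * (2 / x) := by
    rw [← Real.rpow_add_one (by positivity), sub_add_cancel]
  rw [← hs.tsum_eq, ← tsum_even_add_odd hse hso, tsum_congr heven, tsum_congr hodd, tsum_mul_left,
    tsum_mul_left, ← rpow_mul_besselI (a - 1) hx, ← rpow_mul_besselI a hx, hpow]
  field_simp

/-! ### The moment formulas. -/

section Moments

variable {Ω : Type*} [MeasurableSpace Ω] {P : Measure Ω} [IsProbabilityMeasure P] {c : ℝ}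
  {lam : ℝ≥0} {V : Ω → ℝ} {N : ℝ≥0 → Ω → ℕ}

theorem IsTelegraphData.condMaxMoment_pos (h : IsTelegraphData V N c lam P) (hc : 0 < c)
    (hlam : 0 < lam) {t : ℝ≥0} (ht : 0 < t) (m k : ℕ) :
    condMaxMoment P V N t m {ω | V ω = c ∧ N t ω = k} = c ^ m / t ^ k *
      (maxIntegral 1 k t fun x => ENNReal.ofReal (x ^ m)).toReal := by
  have := h.condMaxMoment_eq hc hlam ht m k (σ := 1) (by simpa using h.prob_pos)
  rwa [one_mul] at this

theorem IsTelegraphData.condMaxMoment_neg (h : IsTelegraphData V N c lam P) (hc : 0 < c)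
    (hlam : 0 < lam) {t : ℝ≥0} (ht : 0 < t) (m k : ℕ) :
    condMaxMoment P V N t m {ω | V ω = -c ∧ N t ω = k} = c ^ m / t ^ k *
      (maxIntegral (-1) k t fun x => ENNReal.ofReal (x ^ m)).toReal := by
  have := h.condMaxMoment_eq hc hlam ht m k (σ := -1) (by simpa using h.prob_neg)
  rwa [neg_one_mul] at this

theorem IsTelegraphData.condMaxMoment_pos_zero (h : IsTelegraphData V N c lam P) (hc : 0 < c)
    (hlam : 0 < lam) {t : ℝ≥0} (ht : 0 < t) (m : ℕ) :
    condMaxMoment P V N t m {ω | V ω = c ∧ N t ω = 0} = (c * t) ^ m := by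
  rw [h.condMaxMoment_pos hc hlam ht, maxIntegral_zero, runMax_one t.coe_nonneg,
    ENNReal.toReal_ofReal (by positivity)]
  ring

theorem IsTelegraphData.condMaxMoment_pos_odd (h : IsTelegraphData V N c lam P) (hc : 0 < c)
    (hlam : 0 < lam) {t : ℝ≥0} (ht : 0 < t) (m k : ℕ) :
    condMaxMoment P V N t m {ω | V ω = c ∧ N t ω = 2 * k + 1} =
      ((2 * k + 1)! : ℝ) * (c * t) ^ m / (2 ^ (2 * k + 1) * (k ! : ℝ)) *
        (Real.Gamma (((m : ℝ) + 1) / 2) / Real.Gamma ((k : ℝ) + 1 + ((m : ℝ) + 1) / 2)) := by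
  have ht' : (0 : ℝ) < t := ht
  rw [h.condMaxMoment_pos hc hlam ht, (hasMaxLawPos_odd k).toReal_maxIntegral (continuous_posOdd k)
    (fun _ _ hx => posOdd_nonneg k hx) ht', integral_pow_mul_posOdd, lawConst]
  generalize Real.Gamma (((m : ℝ) + 1) / 2) / Real.Gamma ((k : ℝ) + 1 + ((m : ℝ) + 1) / 2) = A
  rw [show (4 : ℝ) ^ k = 2 ^ (2 * k) by rw [pow_mul]; norm_num, mul_pow]
  field_simp
  ring

theorem IsTelegraphData.condMaxMoment_pos_even (h : IsTelegraphData V N c lam P) (hc : 0 < c)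
    (hlam : 0 < lam) {t : ℝ≥0} (ht : 0 < t) (m k : ℕ) :
    condMaxMoment P V N t m {ω | V ω = c ∧ N t ω = 2 * k + 2} =
      condMaxMoment P V N t m {ω | V ω = c ∧ N t ω = 2 * k + 1} := by
  have ht' : (0 : ℝ) < t := ht
  rw [h.condMaxMoment_pos hc hlam ht, h.condMaxMoment_pos hc hlam ht,
    (hasMaxLawPos_odd k).toReal_maxIntegral (continuous_posOdd k)
    (fun _ _ hx => posOdd_nonneg k hx) ht', (hasMaxLawPos_even k).toReal_maxIntegral
    (continuous_posEven k) (fun _ _ hx => posEven_nonneg k hx) ht']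
  have h1 : ∀ x, x ^ m * posEven k t x = t / (2 * k + 2) * (x ^ m * posOdd k t x) := fun x => by
    rw [posEven_eq]; ring
  simp_rw [h1]
  rw [intervalIntegral.integral_const_mul, Nat.factorial_succ (2 * k + 1)]
  push_cast
  have : (2 * (k : ℝ) + 2) ≠ 0 := by positivity
  field_simp
  ring

theorem IsTelegraphData.condMaxMoment_neg_even (h : IsTelegraphData V N c lam P) (hc : 0 < c)
    (hlam : 0 < lam) {t : ℝ≥0} (ht : 0 < t) {m : ℕ} (hm : m ≠ 0) (k : ℕ) :
    condMaxMoment P V N t m {ω | V ω = -c ∧ N t ω = 2 * k} =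
      ((2 * k)! : ℝ) * (c * t) ^ m / (2 ^ (2 * k) * (k ! : ℝ)) *
        (Real.Gamma (((m : ℝ) + 1) / 2) / Real.Gamma ((k : ℝ) + ((m : ℝ) + 1) / 2) -
          Real.Gamma ((m : ℝ) / 2 + 1) / Real.Gamma ((k : ℝ) + 1 + (m : ℝ) / 2)) := by
  have ht' : (0 : ℝ) < t := ht
  rw [h.condMaxMoment_neg hc hlam ht, (hasMaxLawNeg_even k).toReal_maxIntegral
    (continuous_negEven k) (fun _ _ hx => negEven_nonneg k hx) ht' hm, integral_pow_mul_negEven,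
    lawConst]
  generalize Real.Gamma (((m : ℝ) + 1) / 2) / Real.Gamma ((k : ℝ) + ((m : ℝ) + 1) / 2) -
    Real.Gamma ((m : ℝ) / 2 + 1) / Real.Gamma ((k : ℝ) + 1 + (m : ℝ) / 2) = A
  rw [show (4 : ℝ) ^ k = 2 ^ (2 * k) by rw [pow_mul]; norm_num, mul_pow]
  field_simp
  ring

theorem IsTelegraphData.condMaxMoment_neg_odd (h : IsTelegraphData V N c lam P) (hc : 0 < c)
    (hlam : 0 < lam) {t : ℝ≥0} (ht : 0 < t) {m : ℕ} (hm : m ≠ 0) (k : ℕ) :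
    condMaxMoment P V N t m {ω | V ω = -c ∧ N t ω = 2 * k + 1} =
      (2 * (k : ℝ) + 1) / (2 * (k : ℝ) + 2) *
          condMaxMoment P V N t m {ω | V ω = -c ∧ N t ω = 2 * k} +
        1 / (2 * (k : ℝ) + 2) *
          condMaxMoment P V N t m {ω | V ω = c ∧ N t ω = 2 * k + 1} := by
  have ht' : (0 : ℝ) < t := ht
  rw [h.condMaxMoment_neg hc hlam ht, h.condMaxMoment_neg hc hlam ht,
    h.condMaxMoment_pos hc hlam ht,
    (hasMaxLawPos_odd k).toReal_maxIntegral (continuous_posOdd k)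
      (fun _ _ hx => posOdd_nonneg k hx) ht',
    (hasMaxLawNeg_even k).toReal_maxIntegral
      (continuous_negEven k) (fun _ _ hx => negEven_nonneg k hx) ht' hm,
    (hasMaxLawNeg_odd k).toReal_maxIntegral
      (continuous_negOdd k) (fun _ _ hx => negOdd_nonneg k hx) ht' hm]
  have h1 : ∀ x, x ^ m * negOdd k t x = t / (2 * k + 2) * (x ^ m * negEven k t x) +
      1 / (2 * k + 2) * (x ^ m * posOdd k t x) := fun x => by
    rw [negOdd_eq]; ring
  have hc1 : Continuous (posOdd k t) :=
    (continuous_posOdd k).comp (f := fun x => ((t : ℝ), x)) (by fun_prop)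
  have hc2 : Continuous (negEven k t) :=
    (continuous_negEven k).comp (f := fun x => ((t : ℝ), x)) (by fun_prop)
  simp_rw [h1]
  rw [intervalIntegral.integral_add (Continuous.intervalIntegrable (by fun_prop) _ _)
    (Continuous.intervalIntegrable (by fun_prop) _ _), intervalIntegral.integral_const_mul,
    intervalIntegral.integral_const_mul, Nat.factorial_succ (2 * k)]
  push_cast
  have : (2 * (k : ℝ) + 2) ≠ 0 := by positivity
  field_simp
  ring

theorem IsTelegraphData.condMaxMoment_one_pos_odd (h : IsTelegraphData V N c lam P) (hc : 0 < c)
    (hlam : 0 < lam) {t : ℝ≥0} (ht : 0 < t) (k : ℕ) :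
    condMaxMoment P V N t 1 {ω | V ω = c ∧ N t ω = 2 * k + 1} =
      (Nat.choose (2 * k + 1) k : ℝ) * (c * t / 2 ^ (2 * k + 1)) := by
  rw [h.condMaxMoment_pos_odd hc hlam ht, Nat.cast_choose ℝ (by omega),
    show 2 * k + 1 - k = k + 1 by omega,
    show (((1 : ℕ) : ℝ) + 1) / 2 = 1 by norm_num, Real.Gamma_one,
    show (k : ℝ) + 1 + 1 = ((k + 1 : ℕ) : ℝ) + 1 by push_cast; ring, Real.Gamma_nat_eq_factorial]
  field_simp

theorem IsTelegraphData.condMaxMoment_two_pos_odd (h : IsTelegraphData V N c lam P) (hc : 0 < c)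
    (hlam : 0 < lam) {t : ℝ≥0} (ht : 0 < t) (k : ℕ) :
    condMaxMoment P V N t 2 {ω | V ω = c ∧ N t ω = 2 * k + 1} =
      c ^ 2 * (t : ℝ) ^ 2 / (2 * (k : ℝ) + 3) := by
  have hk : (0 : ℝ) < k + 1 + 1 / 2 := by positivity
  rw [h.condMaxMoment_pos_odd hc hlam ht,
    show (((2 : ℕ) : ℝ) + 1) / 2 = 1 / 2 + 1 by norm_num,
    show (k : ℝ) + 1 + (1 / 2 + 1) = k + 1 + 1 / 2 + 1 by ring, Real.Gamma_add_one hk.ne',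
    div_mul_eq_div_div_swap (Real.Gamma (1 / 2 + 1)), Gamma_three_halves_div_Gamma,
    show (4 : ℝ) ^ k = 2 ^ (2 * k) by rw [pow_mul]; norm_num,
    show (k : ℝ) + 1 + 1 / 2 = (2 * k + 3) / 2 by ring]
  field_simp
  ring

theorem IsTelegraphData.condMaxMoment_one_neg_even (h : IsTelegraphData V N c lam P) (hc : 0 < c)
    (hlam : 0 < lam) {t : ℝ≥0} (ht : 0 < t) (k : ℕ) :
    condMaxMoment P V N t 1 {ω | V ω = -c ∧ N t ω = 2 * k} =
      c * t * (((2 * k)! : ℝ) / ((k ! : ℝ) ^ 2 * 2 ^ (2 * k))) - c * t / (2 * (k : ℝ) + 1) := by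
  rw [h.condMaxMoment_neg_even hc hlam ht one_ne_zero,
    show (((1 : ℕ) : ℝ) + 1) / 2 = 1 by norm_num, Real.Gamma_one, Nat.cast_one,
    Real.Gamma_nat_eq_factorial, show (1 : ℝ) / 2 + 1 = 1 / 2 + 1 by rfl,
    Gamma_three_halves_div_Gamma, show (4 : ℝ) ^ k = 2 ^ (2 * k) by rw [pow_mul]; norm_num,
    Nat.factorial_succ (2 * k)]
  push_cast
  field_simp

/-- The probability that the maximum is attained at the origin. -/
theorem IsTelegraphData.cond_telegraphMax_eq_zero (h : IsTelegraphData V N c lam P) (hc : 0 < c)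
    (hlam : 0 < lam) {t : ℝ≥0} (ht : 0 < t) (k : ℕ) :
    (ProbabilityTheory.cond P {ω | V ω = -c ∧ N t ω = 2 * k}).real
      {ω | telegraphMax V N t ω = 0} = ((2 * k)! : ℝ) / ((k ! : ℝ) ^ 2 * 2 ^ (2 * k)) := by
  have ht' : (0 : ℝ) < t := ht
  have hac := ProbabilityTheory.cond_absolutelyContinuous (μ := P)
    (s := {ω | V ω = -c ∧ N t ω = 2 * k})
  have hg : Measurable (({0} : Set ℝ).indicator fun _ => (1 : ℝ≥0∞)) :=
    measurable_const.indicator (measurableSet_singleton 0)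
  have h1 := h.lintegral_cond hc.le hlam ht (2 * k) (σ := -1) (by simpa using h.prob_neg) hg
  rw [hasMaxLawNeg_even k t ht' (fun x => ({0} : Set ℝ).indicator (fun _ => 1) (c * x))
    (hg.comp (measurable_const_mul c)), neg_one_mul] at h1
  -- With the indicator of `{0}` as test function the density part vanishes, so the conditional
  -- probability is the normalised atom.
  have h2 : ∫⁻ x in Set.Ioo 0 (t : ℝ), ENNReal.ofReal (negEven k t x) *
      ({0} : Set ℝ).indicator (fun _ => (1 : ℝ≥0∞)) (c * x) = 0 := by
    rw [setLIntegral_congr_fun (g := fun _ => 0) measurableSet_Ioo, lintegral_zero]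
    intro x hx
    have : c * x ≠ 0 := (mul_pos hc hx.1).ne'
    simp [this]
  have h3 : ∫⁻ ω, ({0} : Set ℝ).indicator (fun _ => (1 : ℝ≥0∞)) (telegraphMax V N t ω)
      ∂(ProbabilityTheory.cond P {ω | V ω = -c ∧ N t ω = 2 * k}) =
      ProbabilityTheory.cond P {ω | V ω = -c ∧ N t ω = 2 * k} {ω | telegraphMax V N t ω = 0} := by
    rw [← lintegral_indicator_one₀]
    · rfl
    · exact ((h.aemeasurable_telegraphMax hc ht).mono_ac hac).nullMeasurable
        (measurableSet_singleton 0)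
  rw [h2, h3, add_zero, mul_zero, Set.indicator_of_mem (Set.mem_singleton _), mul_one] at h1
  have hC := lawConst_pos k
  rw [measureReal_def, h1, ENNReal.toReal_mul, ENNReal.toReal_mul, ENNReal.toReal_natCast,
    ENNReal.toReal_ofReal (by positivity), ENNReal.toReal_ofReal (by positivity), lawConst,
    show (4 : ℝ) ^ k = 2 ^ (2 * k) by rw [pow_mul]; norm_num]
  field_simp

theorem IsTelegraphData.condMaxMoment_pos_total (h : IsTelegraphData V N c lam P) (hc : 0 < c)
    (hlam : 0 < lam) {t : ℝ≥0} (ht : 0 < t) (m : ℕ) :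
    condMaxMoment P V N t m {ω | V ω = c} =
      Real.exp (-(lam * t)) * (c * t) ^ m * (2 / ((lam : ℝ) * t)) ^ (((m : ℝ) - 1) / 2) *
        Real.Gamma (((m : ℝ) + 1) / 2) *
          (besselI (((m : ℝ) - 1) / 2) (lam * t) + besselI (((m : ℝ) + 1) / 2) (lam * t)) := by
  have hx : (0 : ℝ) < lam * t := mul_pos (by exact_mod_cast hlam) (by exact_mod_cast ht)
  have ha : (0 : ℝ) < ((m : ℝ) + 1) / 2 := by positivity
  have hG := (Real.Gamma_pos_of_pos ha).ne'
  rw [HasSum.eq_besselI hx (K := Real.exp (-(lam * t)) * (c * t) ^ m *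
    Real.Gamma (((m : ℝ) + 1) / 2)) (a := ((m : ℝ) + 1) / 2)
    (h.hasSum_condMaxMoment hc hlam ht m), show ((m : ℝ) + 1) / 2 - 1 = ((m : ℝ) - 1) / 2 by ring]
  · ring
  · intro j
    generalize (lam : ℝ) * t = x at *
    rw [show (j : ℝ) + (((m : ℝ) + 1) / 2 - 1) + 1 = j + ((m : ℝ) + 1) / 2 by ring]
    -- The term without reversals is the deterministic maximum `c * t`, outside the formula for
    -- positive even counts; it still fits the series because the Gamma factors cancel at `j = 0`.
    cases j with
    | zero =>
      rw [mul_zero, h.condMaxMoment_pos_zero hc hlam ht]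
      simp only [pow_zero, Nat.factorial_zero, Nat.cast_one, Nat.cast_zero, zero_add, mul_one,
        one_mul, div_one]
      generalize Real.Gamma (((m : ℝ) + 1) / 2) = G at *
      field_simp
    | succ j =>
      rw [show 2 * (j + 1) = 2 * j + 2 by ring, h.condMaxMoment_pos_even hc hlam ht,
        h.condMaxMoment_pos_odd hc hlam ht,
        show ((j + 1 : ℕ) : ℝ) + ((m : ℝ) + 1) / 2 = j + 1 + ((m : ℝ) + 1) / 2 by push_cast; ring,
        Nat.factorial_succ (2 * j + 1), Nat.factorial_succ j]
      have := (Real.Gamma_pos_of_pos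
        (show 0 < (j : ℝ) + 1 + ((m : ℝ) + 1) / 2 by positivity)).ne'
      generalize Real.Gamma ((j : ℝ) + 1 + ((m : ℝ) + 1) / 2) = G' at *
      generalize Real.Gamma (((m : ℝ) + 1) / 2) = G at *
      rw [div_pow]
      push_cast
      field_simp
      ring
  · intro j
    generalize (lam : ℝ) * t = x at *
    rw [h.condMaxMoment_pos_odd hc hlam ht,
      show (j : ℝ) + 1 + ((m : ℝ) + 1) / 2 = j + ((m : ℝ) + 1) / 2 + 1 by ring]
    have := (Real.Gamma_pos_of_pos
      (show 0 < (j : ℝ) + ((m : ℝ) + 1) / 2 + 1 by positivity)).ne'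
    generalize Real.Gamma ((j : ℝ) + ((m : ℝ) + 1) / 2 + 1) = G' at *
    generalize Real.Gamma (((m : ℝ) + 1) / 2) = G at *
    rw [div_pow]
    field_simp
    ring

end Moments

theorem mainTheorem10 {Ω : Type*} [MeasurableSpace Ω] (P : Measure Ω) [IsProbabilityMeasure P]
    (c : ℝ) (hc : 0 < c) (lam : ℝ≥0) (hlam : 0 < lam)
    (V : Ω → ℝ) (N : ℝ≥0 → Ω → ℕ) (hVN : IsTelegraphData V N c lam P)
    (t : ℝ≥0) (ht : 0 < t) :
    -- all moments are finite
    (∀ m : ℕ, 1 ≤ m → Integrable (fun ω => telegraphMax V N t ω ^ m) P) ∧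
    -- positive initial velocity, odd number of reversals, and positive even number of reversals
    (∀ m k : ℕ, 1 ≤ m →
      condMaxMoment P V N t m {ω | V ω = c ∧ N t ω = 2 * k + 1} =
          ((2 * k + 1)! : ℝ) * (c * t) ^ m / (2 ^ (2 * k + 1) * (k ! : ℝ)) *
            (Real.Gamma (((m : ℝ) + 1) / 2) / Real.Gamma ((k : ℝ) + 1 + ((m : ℝ) + 1) / 2)) ∧
      condMaxMoment P V N t m {ω | V ω = c ∧ N t ω = 2 * k + 2} =
          ((2 * k + 1)! : ℝ) * (c * t) ^ m / (2 ^ (2 * k + 1) * (k ! : ℝ)) *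
            (Real.Gamma (((m : ℝ) + 1) / 2) / Real.Gamma ((k : ℝ) + 1 + ((m : ℝ) + 1) / 2))) ∧
    -- mean and second moment in the odd case, and convergence to zero in mean square
    (∀ k : ℕ, condMaxMoment P V N t 1 {ω | V ω = c ∧ N t ω = 2 * k + 1} =
      (Nat.choose (2 * k + 1) k : ℝ) * (c * t / 2 ^ (2 * k + 1))) ∧
    (∀ k : ℕ, condMaxMoment P V N t 2 {ω | V ω = c ∧ N t ω = 2 * k + 1} =
      c ^ 2 * (t : ℝ) ^ 2 / (2 * (k : ℝ) + 3)) ∧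
    Tendsto (fun k : ℕ => condMaxMoment P V N t 2 {ω | V ω = c ∧ N t ω = 2 * k + 1})
      atTop (𝓝 0) ∧
    -- positive initial velocity, without conditioning on the number of reversals
    (∀ m : ℕ, 1 ≤ m →
      condMaxMoment P V N t m {ω | V ω = c} =
        Real.exp (-(lam * t)) * (c * t) ^ m * (2 / ((lam : ℝ) * t)) ^ (((m : ℝ) - 1) / 2) *
          Real.Gamma (((m : ℝ) + 1) / 2) *
            (besselI (((m : ℝ) - 1) / 2) (lam * t) + besselI (((m : ℝ) + 1) / 2) (lam * t))) ∧
    condMaxMoment P V N t 1 {ω | V ω = c} =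
      Real.exp (-(lam * t)) * (c * t) * (besselI 0 (lam * t) + besselI 1 (lam * t)) ∧
    -- negative initial velocity, even number of reversals
    (∀ m k : ℕ, 1 ≤ m →
      condMaxMoment P V N t m {ω | V ω = -c ∧ N t ω = 2 * k} =
        ((2 * k)! : ℝ) * (c * t) ^ m / (2 ^ (2 * k) * (k ! : ℝ)) *
          (Real.Gamma (((m : ℝ) + 1) / 2) / Real.Gamma ((k : ℝ) + ((m : ℝ) + 1) / 2) -
            Real.Gamma ((m : ℝ) / 2 + 1) / Real.Gamma ((k : ℝ) + 1 + (m : ℝ) / 2))) ∧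
    (∀ k : ℕ,
      condMaxMoment P V N t 1 {ω | V ω = -c ∧ N t ω = 2 * k} =
          c * t * (((2 * k)! : ℝ) / ((k ! : ℝ) ^ 2 * 2 ^ (2 * k))) -
            c * t / (2 * (k : ℝ) + 1) ∧
      condMaxMoment P V N t 1 {ω | V ω = -c ∧ N t ω = 2 * k} =
          c * t * (ProbabilityTheory.cond P {ω | V ω = -c ∧ N t ω = 2 * k}).real
              {ω | telegraphMax V N t ω = 0} -
            c * t / (2 * (k : ℝ) + 1)) ∧
    (∀ k : ℕ, k ≠ 2 →
      condMaxMoment P V N t 1 {ω | V ω = -c ∧ N t ω = 2 * k} <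
        condMaxMoment P V N t 1 {ω | V ω = -c ∧ N t ω = 2 * 2}) ∧
    -- negative initial velocity, odd number of reversals
    (∀ m k : ℕ, 1 ≤ m →
      condMaxMoment P V N t m {ω | V ω = -c ∧ N t ω = 2 * k + 1} =
        (2 * (k : ℝ) + 1) / (2 * (k : ℝ) + 2) *
            condMaxMoment P V N t m {ω | V ω = -c ∧ N t ω = 2 * k} +
          1 / (2 * (k : ℝ) + 2) *
            condMaxMoment P V N t m {ω | V ω = c ∧ N t ω = 2 * k + 1}) := by
  have hmain1 := fun m => hVN.condMaxMoment_pos_total hc hlam ht m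
  refine ⟨fun m _ => hVN.integrable_telegraphMax_pow hc ht m, fun m k _ => ⟨?_, ?_⟩,
    fun k => hVN.condMaxMoment_one_pos_odd hc hlam ht k,
    fun k => hVN.condMaxMoment_two_pos_odd hc hlam ht k, ?_, fun m _ => hmain1 m, ?_,
    fun m k hm => hVN.condMaxMoment_neg_even hc hlam ht (by omega) k,
    fun k => ⟨hVN.condMaxMoment_one_neg_even hc hlam ht k, ?_⟩, fun k hk => ?_,
    fun m k hm => hVN.condMaxMoment_neg_odd hc hlam ht (by omega) k⟩
  · exact hVN.condMaxMoment_pos_odd hc hlam ht m k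
  · rw [hVN.condMaxMoment_pos_even hc hlam ht, hVN.condMaxMoment_pos_odd hc hlam ht]
  · simp_rw [hVN.condMaxMoment_two_pos_odd hc hlam ht]
    refine tendsto_const_nhds.div_atTop ?_
    exact tendsto_atTop_add_const_right _ _
      (tendsto_natCast_atTop_atTop.const_mul_atTop two_pos)
  · rw [hmain1 1]
    norm_num
  · rw [hVN.cond_telegraphMax_eq_zero hc hlam ht, hVN.condMaxMoment_one_neg_even hc hlam ht]
  · rw [hVN.condMaxMoment_one_neg_even hc hlam ht, hVN.condMaxMoment_one_neg_even hc hlam ht]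
    have hct : 0 < c * t := mul_pos hc (by exact_mod_cast ht)
    have := mul_lt_mul_of_pos_left (centralBinom_sub_lt hk) hct
    rw [mul_sub, mul_sub, mul_one_div, mul_one_div] at this
    exact this
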